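/- Let $V$ be a real vector space of finite dimension $d$, and let $\mathcal K(V)$ be the set of convex bodies (nonempty compact convex subsets) of $V$, with the topology of the Hausdorff metric. Let $G$ be a group of affine transformations of $V$ that contains all translations. A map $\varphi\colon\mathcal K(V)\to A$ to an abelian group is a valuation if $\varphi(B\cup C)=\varphi(B)+\varphi(C)-\varphi(B\cap C)$ whenever $B,C,B\cup C\in\mathcal K(V)$. Let $\mathcal{CB}=\mathcal{CB}(V,G)$ be the quotient of the free Hausdorff topological abelian group $\mathbb Z\mathcal K(V)$ on the space $\mathcal K(V)$ by the closed subgroup generated by the elements $[B\cup C]-[B]-[C]+[B\cap C]$ ($B,C,B\cup C\in\mathcal K(V)$) and $[X]-[gX]$ ($X\in\mathcal K(V)$, $g\in G$), and let $\Phi\colon\mathcal K(V)\to\mathcal{CB}$, $\Phi(X)=[X]$, be the universal continuous $G$-invariant valuation. Then the following hold. (a) There is a unique continuous map $D\colon[0,\infty)\times\mathcal{CB}\to\mathcal{CB}$ that is a homomorphism in the second variable and satisfies $D(\lambda,[X])=[\lambda X]$ for all $\lambda\in[0,\infty)$ and $X\in\mathcal K(V)$. There are unique maps $\rho_0\colon\mathcal{CB}\to\mathcal{CB}$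 and $\rho_1,\dots,\rho_d\colon[0,\infty)\times\mathcal{CB}\to\mathcal{CB}$, with $\rho_1,\dots,\rho_d$ additive in the first variable, such that $$D(\lambda,x)=\rho_0(x)+\rho_1(\lambda,x)+\rho_2(\lambda^2,x)+\cdots+\rho_d(\lambda^d,x)\qquad(\lambda\in[0,\infty),\ x\in\mathcal{CB}),$$ and these maps are continuous. (b) The maps $e_0=\rho_0$ and $e_i=\rho_i(1,-)$ for $1\le i\le d$ are continuous endomorphisms of the topological group $\mathcal{CB}$ with $e_0+\cdots+e_d=1$, $e_i^2=e_i$, and $e_ie_j=0$ for $i\ne j$. Their images $\mathcal{CB}_i=e_i(\mathcal{CB})$ are closed subgroups, $\mathcal{CB}$ and the $\mathcal{CB}_i$ are Hausdorff, and $x\mapsto(e_i(x))_i$ is an isomorphism of topological groups $$\mathcal{CB}(V,G)\cong\mathcal{CB}_0\oplus\cdots\oplus\mathcal{CB}_d .$$ Correspondingly $\Phi=\Phi_0\oplus\cdots\oplus\Phi_d$, where each $\Phi_i=e_i\circ\Phi\colon\mathcal K(V)\to\mathcal{CB}_i$ is a continuous $G$-invariant valuation. (c) There is an isomorphism of topological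 groups from the discrete group $\mathbb Z$ onto $\mathcal{CB}_0$ that sends $1$ to $\Phi_0(X)$ for every $X\in\mathcal K(V)$, and this element is the class $[\{v\}]$ of any one-point convex body $\{v\}$. (d) For $1\le i\le d$, $\mathcal{CB}_i$ admits the structure of a Hausdorff topological vector space over $\mathbb R$, extending its structure as a topological abelian group, with respect to which $\Phi_i(\lambda X)=\lambda^i\,\Phi_i(X)$ for all $\lambda\in[0,\infty)$ and $X\in\mathcal K(V)$. -/

import Mathlib

open scoped NNReal

noncomputable section

/-! ### Free (Hausdorff) topological abelian groups -/

/-- The free topological abelian group on a topological space `X`: the free abelian group on `X`,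
with the finest group topology for which the inclusion of generators is continuous. -/
def FreeTAG (X : Type*) : Type _ := FreeAbelianGroup X

instance FreeTAG.instAddCommGroup (X : Type*) : AddCommGroup (FreeTAG X) :=
  inferInstanceAs (AddCommGroup (FreeAbelianGroup X))

/-- The inclusion of generators. -/
def FreeTAG.of {X : Type*} (x : X) : FreeTAG X := FreeAbelianGroup.of x

/-- The finest group topology for which `FreeTAG.of` is continuous. In the order on
`AddGroupTopology`, smaller means finer, so this is an infimum (the topology generated by all the
group topologies in question). -/
def FreeTAG.groupTopology (X : Type*) [TopologicalSpace X] : AddGroupTopology (FreeTAG X) :=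
  sInf {t : AddGroupTopology (FreeTAG X) |
    @Continuous X (FreeTAG X) _ t.toTopologicalSpace FreeTAG.of}

instance FreeTAG.instTopologicalSpace (X : Type*) [TopologicalSpace X] :
    TopologicalSpace (FreeTAG X) :=
  (FreeTAG.groupTopology X).toTopologicalSpace

instance FreeTAG.instIsTopologicalAddGroup (X : Type*) [TopologicalSpace X] :
    IsTopologicalAddGroup (FreeTAG X) :=
  (FreeTAG.groupTopology X).toIsTopologicalAddGroup

/-- The free Hausdorff topological abelian group on `X`: the Hausdorff reflection
(the quotient by the closure of `{0}`) of the free topological abelian group. -/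
abbrev FreeHTAG (X : Type*) [TopologicalSpace X] : Type _ :=
  FreeTAG X ⧸ (⊥ : AddSubgroup (FreeTAG X)).topologicalClosure

/-- The class `[x]` of a point `x`. -/
def FreeHTAG.of {X : Type*} [TopologicalSpace X] (x : X) : FreeHTAG X :=
  QuotientAddGroup.mk (FreeTAG.of x)

/-! ### Convex bodies, valuations and the group of convex bodies -/

section ConvexBodies

variable {V : Type*} [NormedAddCommGroup V] [NormedSpace ℝ V] [FiniteDimensional ℝ V]

/-- The image `gK` of a convex body `K` under an affine transformation `g`. -/
def affineImage (g : V ≃ᵃ[ℝ] V) (K : ConvexBody V) : ConvexBody V where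
  carrier := g '' (K : Set V)
  convex' := K.convex.affine_image (g : V →ᵃ[ℝ] V)
  isCompact' := K.isCompact.image (g : V →ᵃ[ℝ] V).continuous_of_finiteDimensional
  nonempty' := K.nonempty.image g

/-- Valuations on convex bodies with values in an abelian group. Here `U` and `I` are the union and
the intersection of `B` and `C`. (When `B ∪ C` is convex, it is connected, so that `B ∩ C` is
automatically nonempty, hence a convex body.) -/
def IsValuation {A : Type*} [AddCommGroup A] (φ : ConvexBody V → A) : Prop :=
  ∀ B C U I : ConvexBody V, (U : Set V) = (B : Set V) ∪ C → (I : Set V) = (B : Set V) ∩ C →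
    φ U = φ B + φ C - φ I

/-- Invariance of a function on convex bodies under a group of affine transformations. -/
def IsAffineInvariant (G : Subgroup (V ≃ᵃ[ℝ] V)) {A : Type*} (φ : ConvexBody V → A) : Prop :=
  ∀ g ∈ G, ∀ K : ConvexBody V, φ (affineImage g K) = φ K

/-- The elements `[B ∪ C] - [B] - [C] + [B ∩ C]` and `[K] - [gK]` of the free Hausdorff
topological abelian group on the space of convex bodies (with the Hausdorff metric). -/
def convexBodyRelations (G : Subgroup (V ≃ᵃ[ℝ] V)) : Set (FreeHTAG (ConvexBody V)) :=
  {z | ∃ B C U I : ConvexBody V, (U : Set V) = (B : Set V) ∪ C ∧ (I : Set V) = (B : Set V) ∩ C ∧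
      z = FreeHTAG.of U - FreeHTAG.of B - FreeHTAG.of C + FreeHTAG.of I} ∪
  {z | ∃ g ∈ G, ∃ K : ConvexBody V, z = FreeHTAG.of K - FreeHTAG.of (affineImage g K)}

variable (V) in
/-- The group of convex bodies: the quotient of the free Hausdorff topological
abelian group on the space of convex bodies by the closed subgroup generated by the relations. -/
abbrev CB (G : Subgroup (V ≃ᵃ[ℝ] V)) : Type _ :=
  FreeHTAG (ConvexBody V) ⧸ (AddSubgroup.closure (convexBodyRelations G)).topologicalClosure

/-- The universal valuation `Φ(X) = [X]`. -/
def universalValuation (G : Subgroup (V ≃ᵃ[ℝ] V)) (X : ConvexBody V) : CB V G :=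
  QuotientAddGroup.mk (FreeHTAG.of X)

/-- A dilation map: a jointly continuous family of endomorphisms `D(r, -)`, `r ∈ [0,∞)`, of the
group of convex bodies with `D(r, [X]) = [rX]`. -/
def IsDilationMap (G : Subgroup (V ≃ᵃ[ℝ] V)) (D : ℝ≥0 → CB V G →+ CB V G) : Prop :=
  Continuous (fun p : ℝ≥0 × CB V G => D p.1 p.2) ∧
  ∀ (r : ℝ≥0) (X : ConvexBody V), D r (universalValuation G X) = universalValuation G (r • X)

end ConvexBodies

/-- A polynomial expansion `f(a) = c₀ + c₁(a¹) + ⋯ + c_d(a^d)` of `f : [0,∞) → M`, where `c₀` is a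
constant (here: a constant function) and `c₁, …, c_d` are homomorphisms `[0,∞) → M`. -/
def IsPolynomialExpansion {M : Type*} [AddCommGroup M] {d : ℕ} (f : ℝ≥0 → M)
    (c : Fin (d + 1) → ℝ≥0 → M) : Prop :=
  (∀ a b : ℝ≥0, c 0 a = c 0 b) ∧
  (∀ i : Fin (d + 1), i ≠ 0 → ∀ a b : ℝ≥0, c i (a + b) = c i a + c i b) ∧
  ∀ a : ℝ≥0, f a = ∑ i : Fin (d + 1), c i (a ^ (i : ℕ))

end

/-! The heart is that, for a continuous translation-invariant valuation φ, the function r ↦ φ(rX)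
has vanishing (d+1)-fold differences. If X is the hull of n points, it is a linear image of a
standard simplex. Cutting a dilated simplex by coordinate half-spaces gives translates of smaller
dilates, so an n-fold difference is an alternating sum of cuts. By the valuation property this sum
sees only one corner of the simplex, which is a single point, and so it vanishes
(`iterDiff_smul_convexHull_range`). More than d+1 points are affinely dependent, and a Radon-type
dissection writes the class of their hull through hulls of fewer points
(`setExtension_convexHull_eq_zero`). Density of polytopes gives all bodies
(`IsValuation.iterDiff_smul_eq_zero`).

The dilation D comes from the universal property applied to the valuation X ↦ (r ↦ [rX]) with values
in C([0,∞), CB). Since its (d+1)-fold differences vanish, its d-fold differences are multiadditive,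
and continuity makes them multilinear over [0,∞). They therefore yield a top coefficient, and
subtracting its term lowers the degree (`exists_polynomialExpansion`). Division takes place only in
[0,∞), never in CB.

Expansions are unique (`IsPolynomialExpansion.unique`). Comparing expansions in D(r, D(s, x)) =
D(rs, x) gives ρ_i(b, ρ_j(s, x)) = δ_ij ρ_i(bs, x), whence the idempotents, the splitting, and the
real scalar multiplication in positive degree. In degree 0, setting r = 0 shows that every body goes
to the class of a point, and the Euler characteristic shows that this class generates a copy of ℤ.
-/

/-! ### Iterated differences and polynomial expansions -/

section IteratedDifferences

variable {M N : Type*} [AddCommGroup M] [AddCommGroup N]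

/-- The iterated difference `Δ_{a₁} ⋯ Δ_{aₙ} f` of a function on `[0,∞)`,
where `(Δ_a f)(x) = f(x + a) - f(x)`. -/
def iterDiff : List ℝ≥0 → (ℝ≥0 → M) → ℝ≥0 → M
  | [], f, x => f x
  | a :: l, f, x => iterDiff l f (x + a) - iterDiff l f x

@[simp]
theorem iterDiff_nil (f : ℝ≥0 → M) (x : ℝ≥0) : iterDiff [] f x = f x := rfl

theorem iterDiff_cons (a : ℝ≥0) (l : List ℝ≥0) (f : ℝ≥0 → M) (x : ℝ≥0) :
    iterDiff (a :: l) f x = iterDiff l f (x + a) - iterDiff l f x := rfl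

theorem iterDiff_perm {l l' : List ℝ≥0} (h : l.Perm l') (f : ℝ≥0 → M) (x : ℝ≥0) :
    iterDiff l f x = iterDiff l' f x := by
  induction h generalizing x with
  | nil => rfl
  | cons a _ ih => simp only [iterDiff_cons, ih]
  | swap a b l =>
    simp only [iterDiff_cons, add_right_comm x a b]
    abel
  | trans _ _ ih₁ ih₂ => rw [ih₁, ih₂]

theorem iterDiff_map (g : M →+ N) (l : List ℝ≥0) (f : ℝ≥0 → M) (x : ℝ≥0) :
    iterDiff l (fun y => g (f y)) x = g (iterDiff l f x) := by
  induction l generalizing x with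
  | nil => rfl
  | cons a l ih => simp only [iterDiff_cons, ih, map_sub]

theorem iterDiff_sub (l : List ℝ≥0) (f g : ℝ≥0 → M) (x : ℝ≥0) :
    iterDiff l (fun y => f y - g y) x = iterDiff l f x - iterDiff l g x := by
  induction l generalizing x with
  | nil => rfl
  | cons a l ih => simp only [iterDiff_cons, ih]; abel

theorem iterDiff_add (l : List ℝ≥0) (f g : ℝ≥0 → M) (x : ℝ≥0) :
    iterDiff l (fun y => f y + g y) x = iterDiff l f x + iterDiff l g x := by
  induction l generalizing x with
  | nil => rfl
  | cons a l ih => simp only [iterDiff_cons, ih]; abel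

theorem iterDiff_zero (l : List ℝ≥0) (x : ℝ≥0) : iterDiff l (fun _ => (0 : M)) x = 0 := by
  induction l generalizing x with
  | nil => rfl
  | cons a l ih => simp only [iterDiff_cons, ih, sub_zero]

theorem iterDiff_sum {ι : Type*} (s : Finset ι) (l : List ℝ≥0) (f : ι → ℝ≥0 → M) (x : ℝ≥0) :
    iterDiff l (fun y => ∑ i ∈ s, f i y) x = ∑ i ∈ s, iterDiff l (f i) x := by
  classical
  induction s using Finset.induction_on with
  | empty => simp [iterDiff_zero]
  | insert i s hi ih => simp only [Finset.sum_insert hi, iterDiff_add, ih]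

/-- Difference operators commute, so the outermost one may be applied to `f` first. This is the form
needed to lower a degree by one. -/
theorem iterDiff_cons' (a : ℝ≥0) (l : List ℝ≥0) (f : ℝ≥0 → M) (x : ℝ≥0) :
    iterDiff (a :: l) f x = iterDiff l (fun y => f (y + a) - f y) x := by
  induction l generalizing x with
  | nil => rfl
  | cons b l ih =>
    rw [iterDiff_perm (List.Perm.swap b a l), iterDiff_cons b, ih, ih, iterDiff_cons b]

theorem iterDiff_const_mul (c : ℝ) (l : List ℝ≥0) (f : ℝ≥0 → ℝ) (x : ℝ≥0) :
    iterDiff l (fun y => c * f y) x = c * iterDiff l f x :=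
  iterDiff_map (AddMonoidHom.mulLeft c) l f x

theorem continuous_iterDiff [TopologicalSpace M] [IsTopologicalAddGroup M] {Y : Type*}
    [TopologicalSpace Y] {F : ℝ≥0 → Y → M} (hF : Continuous fun p : ℝ≥0 × Y => F p.1 p.2)
    (l : List ℝ≥0) : Continuous fun p : ℝ≥0 × Y => iterDiff l (fun x => F x p.2) p.1 := by
  induction l with
  | nil => exact hF
  | cons a l ih =>
    exact (ih.comp ((continuous_fst.add continuous_const).prodMk continuous_snd)).sub ih

theorem iterDiff_pow (l : List ℝ≥0) :
    (∀ k < l.length, ∀ x, iterDiff l (fun y => (y : ℝ) ^ k) x = 0) ∧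
      ∀ x, iterDiff l (fun y => (y : ℝ) ^ l.length) x = l.length.factorial * (l.prod : ℝ) := by
  induction l with
  | nil => simp
  | cons a l ih =>
    -- Binomial expansion of (y + a)^k - y^k: the top power cancels, so one difference lowers the
    -- degree.
    have key (k : ℕ) (x : ℝ≥0) : iterDiff (a :: l) (fun y => (y : ℝ) ^ k) x =
        ∑ j ∈ Finset.range k, ((a : ℝ) ^ (k - j) * k.choose j) *
          iterDiff l (fun y => (y : ℝ) ^ j) x := by
      rw [iterDiff_cons']
      simp only [← iterDiff_const_mul, ← iterDiff_sum]
      congr 1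
      funext y
      rw [NNReal.coe_add, add_pow, Finset.sum_range_succ]
      simp only [Nat.sub_self, pow_zero, mul_one, Nat.choose_self, Nat.cast_one,
        add_sub_cancel_right]
      exact Finset.sum_congr rfl fun j _ => by ring
    refine ⟨fun k hk x => ?_, fun x => ?_⟩
    · rw [key]
      refine Finset.sum_eq_zero fun j hj => ?_
      rw [ih.1 j (by simp at hk hj; omega), mul_zero]
    · rw [key, List.length_cons, Finset.sum_range_succ, Finset.sum_eq_zero fun j hj => by
        rw [ih.1 j (by simpa using hj), mul_zero], ih.2]
      simp [Nat.factorial_succ]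
      ring

/-- ℝ is the group of differences of [0,∞). The extension lets differences be pulled through `c`,
and later supplies additivity of the scalar multiplication by ℝ. -/
theorem exists_addMonoidHom_eq_toNNReal_sub {c : ℝ≥0 → M} (hc : ∀ a b, c (a + b) = c a + c b) :
    ∃ g : ℝ →+ M, ∀ r, g r = c r.toNNReal - c (-r).toNNReal := by
  refine ⟨AddMonoidHom.mk' (fun r => c r.toNNReal - c (-r).toNNReal) fun r s => ?_, fun r => rfl⟩
  have h : (r + s).toNNReal + (-r).toNNReal + (-s).toNNReal =
      (-(r + s)).toNNReal + r.toNNReal + s.toNNReal := by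
    ext
    have hm (t : ℝ) : max t 0 - max (-t) 0 = t := by
      rcases le_total t 0 with h | h <;> simp [h]
    push_cast [Real.coe_toNNReal']
    linarith [hm r, hm s, hm (r + s)]
  have := congrArg c h
  simp only [hc] at this
  rw [← sub_eq_zero] at this ⊢
  rw [← this]
  abel

theorem exists_addMonoidHom_real_extension {c : ℝ≥0 → M} (hc : ∀ a b, c (a + b) = c a + c b) :
    ∃ g : ℝ →+ M, ∀ r : ℝ≥0, g r = c r := by
  obtain ⟨g, hg⟩ := exists_addMonoidHom_eq_toNNReal_sub hc
  have h0 : c 0 = 0 := by simpa using hc 0 0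
  exact ⟨g, fun r => by simp [hg, h0, Real.toNNReal_of_nonpos]⟩

theorem iterDiff_comp_pow_of_lt {c : ℝ≥0 → M} (hc : ∀ a b, c (a + b) = c a + c b)
    (l : List ℝ≥0) (k : ℕ) (hk : k < l.length) (x : ℝ≥0) :
    iterDiff l (fun y => c (y ^ k)) x = 0 := by
  obtain ⟨g, hg⟩ := exists_addMonoidHom_real_extension hc
  simp only [← hg, NNReal.coe_pow]
  rw [iterDiff_map, (iterDiff_pow l).1 k hk, map_zero]

theorem iterDiff_comp_pow_length {c : ℝ≥0 → M} (hc : ∀ a b, c (a + b) = c a + c b)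
    (l : List ℝ≥0) (x : ℝ≥0) :
    iterDiff l (fun y => c (y ^ l.length)) x = c (l.length.factorial * l.prod) := by
  obtain ⟨g, hg⟩ := exists_addMonoidHom_real_extension hc
  simp only [← hg, NNReal.coe_pow]
  rw [iterDiff_map, (iterDiff_pow l).2]
  push_cast
  rfl

/-- A biadditive, separately continuous map on `[0,∞)²` is bilinear over `[0,∞)`. -/
theorem biadditive_eq_mul_one [TopologicalSpace M] [T2Space M] {B : ℝ≥0 → ℝ≥0 → M}
    (hl : ∀ a a' b, B (a + a') b = B a b + B a' b) (hr : ∀ a b b', B a (b + b') = B a b + B a b')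
    (cl : ∀ b, Continuous fun a => B a b) (cr : ∀ a, Continuous fun b => B a b) (a b : ℝ≥0) :
    B a b = B (a * b) 1 := by
  have hln (n : ℕ) (hn : n ≠ 0) (a b : ℝ≥0) : B (n * a) b = n • B a b := by
    induction n, Nat.one_le_iff_ne_zero.2 hn using Nat.le_induction with
    | base => simp
    | succ n hn' ih => rw [Nat.cast_succ, add_mul, one_mul, hl, ih (by omega), succ_nsmul]
  have hrn (n : ℕ) (hn : n ≠ 0) (a b : ℝ≥0) : B a (n * b) = n • B a b := by
    induction n, Nat.one_le_iff_ne_zero.2 hn using Nat.le_induction with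
    | base => simp
    | succ n hn' ih => rw [Nat.cast_succ, add_mul, one_mul, hr, ih (by omega), succ_nsmul]
  have hrat (m n : ℕ) (hn : n ≠ 0) : B a (m / n) = B (a * (m / n)) 1 := by
    rcases eq_or_ne m 0 with rfl | hm
    · have h1 : B a 0 = 0 := by simpa using hr a 0 0
      have h2 : B 0 1 = 0 := by simpa using hl 0 0 1
      simp [h1, h2]
    · have hn' : (n : ℝ≥0) ≠ 0 := by exact_mod_cast hn
      -- Moving the factor n from one argument to the other avoids dividing by n in M.
      calc B a (m / n) = B (n * (a / n)) (m / n) := by rw [mul_div_cancel₀ _ hn']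
        _ = B (a / n) (n * (m / n)) := by rw [hln _ hn, hrn _ hn]
        _ = B (a / n) (m * 1) := by rw [mul_div_cancel₀ _ hn', mul_one]
        _ = B (m * (a / n)) 1 := by rw [hrn _ hm, hln _ hm]
        _ = B (a * (m / n)) 1 := by congr 1; ring
  have hdense : DenseRange fun q : ℚ => (q : ℝ).toNNReal :=
    (show Function.Surjective Real.toNNReal from fun r => ⟨r, Real.toNNReal_coe⟩).denseRange.comp
      Rat.denseRange_cast continuous_real_toNNReal
  have hcast (q : ℚ) : (q : ℝ).toNNReal = (q.num.toNat : ℝ≥0) / (q.den : ℝ≥0) := by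
    rcases le_total q 0 with hq | hq
    · rw [Real.toNNReal_of_nonpos (by exact_mod_cast hq),
        Int.toNat_of_nonpos (Rat.num_nonpos.2 hq)]
      simp
    · have h1 : ((q.num.toNat : ℤ) : ℝ) = q.num := by
        rw [Int.toNat_of_nonneg (Rat.num_nonneg.2 hq)]
      ext
      rw [Real.coe_toNNReal _ (by exact_mod_cast hq), Rat.cast_def, ← h1]
      push_cast
      rfl
  have := hdense.equalizer (cr a) ((cl 1).comp (continuous_const.mul continuous_id :
    Continuous fun b : ℝ≥0 => a * b)) (funext fun q => by
      simp only [Function.comp, hcast, hrat _ _ q.den_ne_zero]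
      rfl)
  exact congrFun this b

/-- If all `(n+1)`-fold differences of a continuous function vanish at `0`, its `n`-fold
differences are multilinear over `[0,∞)`. -/
theorem iterDiff_eq_prod [TopologicalSpace M] [IsTopologicalAddGroup M] [T2Space M] {n : ℕ}
    {f : ℝ≥0 → M} (hf : Continuous f) (h : ∀ l : List ℝ≥0, l.length = n + 1 → iterDiff l f 0 = 0)
    (l l' : List ℝ≥0) (a : ℝ≥0) (hl : (a :: (l ++ l')).length = n) :
    iterDiff (a :: (l ++ l')) f 0 =
      iterDiff ((a * l.prod) :: (List.replicate l.length 1 ++ l')) f 0 := by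
  have hconst (l : List ℝ≥0) (hl : l.length = n) (x : ℝ≥0) : iterDiff l f x = iterDiff l f 0 := by
    have := h (x :: l) (by simp [hl])
    rwa [iterDiff_cons, zero_add, sub_eq_zero] at this
  -- Δ_{a+b} at 0 is Δ_a at b plus Δ_b at 0, and by `hconst` the base point b may be replaced by 0.
  have hadd (l : List ℝ≥0) (hl : l.length + 1 = n) (a b : ℝ≥0) :
      iterDiff ((a + b) :: l) f 0 = iterDiff (a :: l) f 0 + iterDiff (b :: l) f 0 := by
    rw [← hconst (a :: l) (by simpa using hl) b]
    simp only [iterDiff_cons, zero_add, add_comm b a]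
    abel
  have hcont (l : List ℝ≥0) : Continuous fun a => iterDiff (a :: l) f 0 := by
    have := continuous_iterDiff (Y := Unit) (F := fun x _ => f x) (hf.comp continuous_fst) l
    have h2 : Continuous fun x => iterDiff l f x :=
      this.comp (continuous_id.prodMk (continuous_const (y := ())))
    simp only [iterDiff_cons, zero_add]
    exact h2.sub continuous_const
  induction l generalizing a l' with
  | nil => simp
  | cons b l ih =>
    -- The first slot absorbs the others one at a time, each leaving a 1 behind; `l'` collects the
    -- slots already treated.
    have h1 : iterDiff (a :: b :: (l ++ l')) f 0 = iterDiff ((a * b) :: 1 :: (l ++ l')) f 0 := by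
      have hs (x y : ℝ≥0) := iterDiff_perm (List.Perm.swap x y (l ++ l')) f 0
      simp only [List.cons_append, List.length_cons] at hl
      refine biadditive_eq_mul_one (B := fun x y => iterDiff (x :: y :: (l ++ l')) f 0)
        (fun x x' y => hadd _ (by simpa using hl) x x') (fun x y y' => ?_)
        (fun y => hcont _) (fun x => ?_) a b
      · simp only [← hs x]
        exact hadd _ (by simpa using hl) y y'
      · simp only [← hs x]
        exact hcont _
    have h2 : ((a * b) :: 1 :: (l ++ l')).Perm ((a * b) :: (l ++ 1 :: l')) :=
      List.Perm.cons _ List.perm_middle.symm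
    rw [List.cons_append, h1, iterDiff_perm h2, ih _ _ (by simp at hl ⊢; omega)]
    rw [List.prod_cons, mul_assoc, List.length_cons, List.replicate_succ, List.cons_append]
    exact iterDiff_perm (List.Perm.cons _ List.perm_middle) f 0

/-- A jointly continuous family of functions on `[0,∞)` all of whose `(n+1)`-fold differences
vanish at `0` has a jointly continuous polynomial expansion of degree `n`. -/
theorem exists_polynomialExpansion [TopologicalSpace M] [IsTopologicalAddGroup M] [T2Space M]
    {Y : Type*} [TopologicalSpace Y] (n : ℕ) (F : ℝ≥0 → Y → M)
    (hF : Continuous fun p : ℝ≥0 × Y => F p.1 p.2)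
    (h : ∀ y, ∀ l : List ℝ≥0, l.length = n + 1 → iterDiff l (fun x => F x y) 0 = 0) :
    ∃ c : Fin (n + 1) → ℝ≥0 → Y → M, (∀ i, Continuous fun p : ℝ≥0 × Y => c i p.1 p.2) ∧
      ∀ y, IsPolynomialExpansion (fun x => F x y) (fun i x => c i x y) := by
  induction n generalizing F with
  | zero =>
    refine ⟨fun _ _ y => F 0 y, fun i => hF.comp (continuous_const.prodMk continuous_snd),
      fun y => ⟨fun _ _ => rfl, fun i hi => absurd (Fin.fin_one_eq_zero i) hi, fun a => ?_⟩⟩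
    have := h y [a] rfl
    simpa [iterDiff_cons, sub_eq_zero] using this
  | succ n ih =>
    let l₁ : List ℝ≥0 := List.replicate n 1
    -- A leading coefficient c must satisfy Δ_{a₁}⋯Δ_{aₙ₊₁} F = c((n+1)! ∏ aᵢ). Steps b/(n+1)!, 1,
    -- …, 1 recover c(b), with the factorial divided out in [0,∞).
    let top (b : ℝ≥0) (y : Y) : M :=
      iterDiff (b / ((n + 1).factorial : ℝ≥0) :: l₁) (fun x => F x y) 0
    have hfac : ((n + 1).factorial : ℝ≥0) ≠ 0 := by exact_mod_cast (n + 1).factorial_ne_zero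
    have htop : Continuous fun p : ℝ≥0 × Y => top p.1 p.2 := by
      have := continuous_iterDiff hF l₁
      simp only [top, iterDiff_cons, zero_add]
      exact (this.comp ((continuous_fst.div_const _).prodMk continuous_snd)).sub
        (this.comp (continuous_const.prodMk continuous_snd))
    have hadd (y : Y) (a b : ℝ≥0) : top (a + b) y = top a y + top b y := by
      have hconst := h y (b / ((n + 1).factorial : ℝ≥0) :: a / ((n + 1).factorial : ℝ≥0) :: l₁)
        (by simp [l₁])
      simp only [top, iterDiff_cons, zero_add, add_div] at hconst ⊢
      rw [← sub_eq_zero, ← hconst, add_comm (b / _)]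
      abel
    obtain ⟨c, hc, hexp⟩ := ih (fun x y => F x y - top (x ^ (n + 1)) y)
      (hF.sub (htop.comp ((continuous_fst.pow _).prodMk continuous_snd))) fun y l hl => by
        rw [iterDiff_sub, sub_eq_zero]
        have h1 := iterDiff_comp_pow_length (c := fun b => top b y) (hadd y) l 0
        rw [hl] at h1
        rw [h1]
        obtain ⟨a, l, rfl⟩ := List.exists_cons_of_length_eq_add_one hl
        have h2 := iterDiff_eq_prod (n := n + 1) (f := fun x => F x y)
          (hF.comp (continuous_id.prodMk continuous_const)) (h y) l [] a (by simpa using hl)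
        simp only [List.append_nil] at h2
        rw [h2]
        simp only [top, mul_div_cancel_left₀ _ hfac, List.prod_cons]
        simp only [List.length_cons, Nat.add_right_cancel_iff] at hl
        rw [hl]
    refine ⟨Fin.snoc c top, fun i => ?_, fun y => ⟨?_, fun i hi => ?_, fun a => ?_⟩⟩
    · induction i using Fin.lastCases with
      | last => simpa using htop
      | cast i => simpa using hc i
    · have : (0 : Fin (n + 1 + 1)) = Fin.castSucc 0 := rfl
      simp only [this, Fin.snoc_castSucc]
      exact (hexp y).1
    · induction i using Fin.lastCases with
      | last => simpa using hadd y
      | cast i =>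
        simp only [Fin.snoc_castSucc]
        exact (hexp y).2.1 i (by rintro rfl; exact hi rfl)
    · have := (hexp y).2.2 a
      rw [sub_eq_iff_eq_add] at this
      rw [Fin.sum_univ_castSucc]
      simp only [Fin.snoc_castSucc, Fin.snoc_last, Fin.val_castSucc, Fin.val_last]
      exact this

/-- A d-fold difference with steps b/d!, 1, …, 1 kills all terms of lower degree and returns the top
coefficient at b; induction on the degree does the rest. -/
theorem IsPolynomialExpansion.eq_zero {d : ℕ} {c : Fin (d + 1) → ℝ≥0 → M}
    (h : IsPolynomialExpansion (fun _ => 0) c) : c = 0 := by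
  induction d with
  | zero =>
    have h1 := h.2.2 1
    funext i a
    obtain rfl := Fin.fin_one_eq_zero i
    rw [h.1 a 1]
    simpa using h1.symm
  | succ d ih =>
    have hlast : ∀ b, c (Fin.last (d + 1)) b = 0 := by
      intro b
      have hfac : ((d + 1).factorial : ℝ≥0) ≠ 0 := by exact_mod_cast (d + 1).factorial_ne_zero
      let l : List ℝ≥0 := (b / ((d + 1).factorial : ℝ≥0)) :: List.replicate d 1
      have hl : l.length = d + 1 := by simp [l]
      have h0 := iterDiff_zero (M := M) l 0
      rw [show (fun _ : ℝ≥0 => (0 : M)) = _ from funext h.2.2, iterDiff_sum,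
        Fin.sum_univ_castSucc, Finset.sum_eq_zero, zero_add] at h0
      · have := iterDiff_comp_pow_length (h.2.1 (Fin.last (d + 1)) (Fin.last_pos).ne') l 0
        rw [hl] at this
        rw [Fin.val_last, this] at h0
        simpa [l, mul_div_cancel₀ _ hfac] using h0
      · intro i _
        rcases eq_or_ne i 0 with rfl | hi
        -- The degree-zero coefficient is constant rather than additive, so it is treated apart.
        · have hc (y : ℝ≥0) : c (Fin.castSucc 0) (y ^ (Fin.castSucc (0 : Fin (d + 1)) : ℕ)) =
              c 0 0 := h.1 _ _
          simp only [hc, l]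
          rw [iterDiff_cons', show (fun y : ℝ≥0 => c 0 0 - c 0 0) = fun _ => 0 by simp,
            iterDiff_zero]
        · refine iterDiff_comp_pow_of_lt (h.2.1 _ fun h0 => hi ?_) l _ (by simp [hl]; omega) 0
          exact Fin.castSucc_injective _ h0
    have hrest : (fun i : Fin (d + 1) => c i.castSucc) = 0 := by
      refine ih ⟨h.1, fun i hi => h.2.1 _ fun h0 => hi (Fin.castSucc_injective _ h0), fun a => ?_⟩
      have := h.2.2 a
      rwa [Fin.sum_univ_castSucc, hlast, add_zero] at this
    funext i b
    induction i using Fin.lastCases with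
    | last => exact hlast b
    | cast i => exact congrFun (congrFun hrest i) b

theorem IsPolynomialExpansion.unique {d : ℕ} {f : ℝ≥0 → M} {c c' : Fin (d + 1) → ℝ≥0 → M}
    (h : IsPolynomialExpansion f c) (h' : IsPolynomialExpansion f c') : c = c' := by
  refine sub_eq_zero.1 (IsPolynomialExpansion.eq_zero
    ⟨fun a b => ?_, fun i hi a b => ?_, fun a => ?_⟩)
  · simp [h.1 a b, h'.1 a b]
  · simp only [Pi.sub_apply, h.2.1 i hi, h'.2.1 i hi]
    abel
  · simp [← h.2.2 a, ← h'.2.2 a]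

end IteratedDifferences

/-! ### Universal properties -/

theorem FreeTAG.continuous_of {X : Type*} [TopologicalSpace X] :
    Continuous (FreeTAG.of : X → FreeTAG X) := by
  refine continuous_iff_coinduced_le.2 ?_
  change _ ≤ (FreeTAG.groupTopology X).toTopologicalSpace
  rw [FreeTAG.groupTopology, AddGroupTopology.toTopologicalSpace_sInf]
  refine le_sInf ?_
  rintro _ ⟨t, ht, rfl⟩
  exact continuous_iff_coinduced_le.1 ht

/-- The homomorphism on the free abelian group extending a given map. -/
def FreeTAG.lift {X A : Type*} [AddCommGroup A] (f : X → A) : FreeTAG X →+ A :=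
  FreeAbelianGroup.lift f

@[simp]
theorem FreeTAG.lift_of {X A : Type*} [AddCommGroup A] (f : X → A) (x : X) :
    FreeTAG.lift f (FreeTAG.of x) = f x :=
  FreeAbelianGroup.lift_apply_of f x

/-- The topology of A pulled back along the lift is one of the group topologies in the infimum that
defines the free topology. -/
theorem FreeTAG.continuous_lift {X A : Type*} [TopologicalSpace X] [AddCommGroup A]
    [τ : TopologicalSpace A] [IsTopologicalAddGroup A] {f : X → A} (hf : Continuous f) :
    Continuous (FreeTAG.lift f) := by
  let t : AddGroupTopology (FreeTAG X) :=
    ⟨TopologicalSpace.induced (FreeTAG.lift f) τ, topologicalAddGroup_induced (FreeTAG.lift f)⟩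
  have ht : FreeTAG.groupTopology X ≤ t :=
    sInf_le (continuous_induced_rng.2 (by simpa [Function.comp_def] using hf))
  exact continuous_iff_le_induced.2 (AddGroupTopology.toTopologicalSpace_le.2 ht)

/-! ### Joint continuity of dilation on the space of convex bodies. -/

section Dilation

variable {V : Type*} [NormedAddCommGroup V] [NormedSpace ℝ V]

/-- Triangle inequality through r • y. Only Y has to be bounded by C, so Y can stay fixed as the
base point while r and X vary. -/
theorem ConvexBody.dist_smul_smul_le (r s : ℝ≥0) (X Y : ConvexBody V) {C : ℝ} (hC : 0 ≤ C)
    (hY : ∀ y ∈ Y, ‖y‖ ≤ C) :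
    dist (r • X) (s • Y) ≤ r * dist X Y + dist r s * C := by
  have key (x y : V) (hy : y ∈ Y) (h : dist x y ≤ dist X Y) :
      dist (r • x) (s • y) ≤ r * dist X Y + dist r s * C := by
    calc dist (r • x) (s • y) ≤ dist (r • x) (r • y) + dist (r • y) (s • y) := dist_triangle _ _ _
      _ = r * dist x y + dist r s * ‖y‖ := by
        simp only [NNReal.smul_def, dist_eq_norm, ← smul_sub, ← sub_smul, norm_smul, NNReal.dist_eq,
          Real.norm_eq_abs, NNReal.abs_eq]
      _ ≤ _ := by gcongr; exact hY y hy
  rw [← ConvexBody.hausdorffDist_coe (r • X)]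
  refine Metric.hausdorffDist_le_of_mem_dist (by positivity) ?_ ?_
  · rintro _ ⟨x, hx, rfl⟩
    obtain ⟨y, hy, hxy⟩ := Y.isCompact.exists_infDist_eq_dist Y.nonempty x
    refine ⟨s • y, ⟨y, hy, rfl⟩, key x y hy ?_⟩
    rw [← hxy]
    exact Metric.infDist_le_hausdorffDist_of_mem hx ConvexBody.hausdorffEDist_ne_top
  · rintro _ ⟨y, hy, rfl⟩
    obtain ⟨x, hx, hxy⟩ := X.isCompact.exists_infDist_eq_dist X.nonempty y
    refine ⟨r • x, ⟨x, hx, rfl⟩, ?_⟩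
    rw [dist_comm]
    refine key x y hy ?_
    rw [dist_comm x, ← hxy, dist_comm X]
    exact Metric.infDist_le_hausdorffDist_of_mem hy ConvexBody.hausdorffEDist_ne_top

theorem ConvexBody.continuous_smul : Continuous fun p : ℝ≥0 × ConvexBody V => p.1 • p.2 := by
  rw [continuous_iff_continuousAt]
  rintro ⟨s, Y⟩
  obtain ⟨C, hC, hY⟩ := Y.isBounded.exists_pos_norm_le
  rw [ContinuousAt, tendsto_iff_dist_tendsto_zero]
  refine squeeze_zero (fun _ => dist_nonneg)
    (fun p => ConvexBody.dist_smul_smul_le p.1 s p.2 Y hC.le hY) ?_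
  have : Continuous fun p : ℝ≥0 × ConvexBody V => (p.1 : ℝ) * dist p.2 Y + dist p.1 s * C := by
    fun_prop
  simpa using this.tendsto (s, Y)

end Dilation

/-! ### The group of convex bodies and its universal property. -/

section ConvexBodies

variable {V : Type*} [NormedAddCommGroup V] [NormedSpace ℝ V] [FiniteDimensional ℝ V]
  (G : Subgroup (V ≃ᵃ[ℝ] V))

theorem continuous_universalValuation : Continuous (universalValuation G) :=
  continuous_quot_mk.comp (continuous_quot_mk.comp FreeTAG.continuous_of)

theorem isValuation_universalValuation : IsValuation (universalValuation G) := by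
  intro B C U I hU hI
  have : (QuotientAddGroup.mk (FreeHTAG.of U - FreeHTAG.of B - FreeHTAG.of C + FreeHTAG.of I) :
      CB V G) = 0 :=
    (QuotientAddGroup.eq_zero_iff _).2 (AddSubgroup.le_topologicalClosure _
      (AddSubgroup.subset_closure (Or.inl ⟨B, C, U, I, hU, hI, rfl⟩)))
  have h : universalValuation G U - universalValuation G B - universalValuation G C +
    universalValuation G I = 0 := this
  rw [← sub_eq_zero, ← h]
  abel

theorem isAffineInvariant_universalValuation : IsAffineInvariant G (universalValuation G) := by
  intro g hg K
  have : (QuotientAddGroup.mk (FreeHTAG.of K - FreeHTAG.of (affineImage g K)) : CB V G) = 0 :=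
    (QuotientAddGroup.eq_zero_iff _).2 (AddSubgroup.le_topologicalClosure _
      (AddSubgroup.subset_closure (Or.inr ⟨g, hg, K, rfl⟩)))
  have h : universalValuation G K - universalValuation G (affineImage g K) = 0 := this
  exact (sub_eq_zero.1 h).symm

instance CB.instT2Space : T2Space (CB V G) := by
  have := AddSubgroup.isClosed_topologicalClosure (AddSubgroup.closure (convexBodyRelations G))
  have := QuotientAddGroup.instT3Space
    (AddSubgroup.closure (convexBodyRelations G)).topologicalClosure
  infer_instance

variable {G}

/-- Only quotients are taken, no completion, so the classes of bodies generate the group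
algebraically. Homomorphisms are thus determined by these classes without any continuity. -/
theorem CB.induction {p : CB V G → Prop} (h_zero : p 0)
    (h_of : ∀ X, p (universalValuation G X)) (h_neg : ∀ x, p x → p (-x))
    (h_add : ∀ x y, p x → p y → p (x + y)) (x : CB V G) : p x := by
  obtain ⟨x, rfl⟩ := QuotientAddGroup.mk_surjective x
  obtain ⟨x, rfl⟩ := QuotientAddGroup.mk_surjective x
  exact FreeAbelianGroup.induction_on (motive := fun x : FreeTAG (ConvexBody V) =>
    p (QuotientAddGroup.mk (QuotientAddGroup.mk x))) x h_zero h_of (fun X => h_neg _)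
    (fun x y => h_add _ _)

theorem CB.hom_ext {A : Type*} [AddCommGroup A] {f g : CB V G →+ A}
    (h : ∀ X, f (universalValuation G X) = g (universalValuation G X)) : f = g := by
  ext x
  refine CB.induction (p := fun x => f x = g x) ?_ h ?_ ?_ x
  · simp
  · intro x hx
    simp [hx]
  · intro x y hx hy
    simp [hx, hy]

/-- Continuous invariant valuations with values in a Hausdorff topological abelian group factor
through the group of convex bodies. -/
theorem CB.exists_lift {A : Type*} [AddCommGroup A] [TopologicalSpace A] [IsTopologicalAddGroup A]
    [T2Space A] {φ : ConvexBody V → A} (hc : Continuous φ) (hv : IsValuation φ)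
    (hi : IsAffineInvariant G φ) :
    ∃ f : CB V G →+ A, Continuous f ∧ ∀ X, f (universalValuation G X) = φ X := by
  let f₀ := FreeTAG.lift φ
  have hf₀ : Continuous f₀ := FreeTAG.continuous_lift hc
  have hker {B : Type _} [AddCommGroup B] [TopologicalSpace B] [IsTopologicalAddGroup B]
      (f : B →+ A) (hf : Continuous f) (S : AddSubgroup B) (hS : S ≤ f.ker) :
      S.topologicalClosure ≤ f.ker :=
    AddSubgroup.topologicalClosure_minimal _ hS (isClosed_singleton.preimage hf)
  let f₁ : FreeHTAG (ConvexBody V) →+ A :=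
    QuotientAddGroup.lift _ f₀ fun x hx => hker f₀ hf₀ ⊥ bot_le hx
  have hf₁ : Continuous f₁ := hf₀.quotient_lift _
  have h₁ (X : ConvexBody V) : f₁ (FreeHTAG.of X) = φ X := FreeTAG.lift_of φ X
  have hrel : AddSubgroup.closure (convexBodyRelations G) ≤ f₁.ker := by
    rw [AddSubgroup.closure_le]
    rintro z (⟨B, C, U, I, hU, hI, rfl⟩ | ⟨g, hg, K, rfl⟩)
    · simp only [SetLike.mem_coe, AddMonoidHom.mem_ker, map_add, map_sub, h₁, hv B C U I hU hI]
      abel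
    · simp only [SetLike.mem_coe, AddMonoidHom.mem_ker, map_sub, h₁, hi g hg K, sub_self]
  exact ⟨QuotientAddGroup.lift _ f₁ fun x hx => hker f₁ hf₁ _ hrel hx, hf₁.quotient_lift _, h₁⟩

end ConvexBodies

/-! ### Valuations on sets, and dissections -/

section SetValuations

variable {E F : Type*} [NormedAddCommGroup E] [NormedSpace ℝ E] [NormedAddCommGroup F]
  [NormedSpace ℝ F] {A : Type*} [AddCommGroup A]

/-- The sets underlying convex bodies: nonempty compact convex sets. -/
def IsConvexBody (s : Set E) : Prop := Convex ℝ s ∧ IsCompact s ∧ s.Nonempty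

theorem ConvexBody.isConvexBody (K : ConvexBody E) : IsConvexBody (K : Set E) :=
  ⟨K.convex, K.isCompact, K.nonempty⟩

theorem IsConvexBody.inter {s t : Set E} (hs : IsConvexBody s) (ht : Convex ℝ t)
    (ht' : IsClosed t) {a : E} (has : a ∈ s) (hat : a ∈ t) : IsConvexBody (s ∩ t) :=
  ⟨hs.1.inter ht, hs.2.1.inter_right ht', a, has, hat⟩

theorem IsConvexBody.image {s : Set E} (hs : IsConvexBody s) (L : E →L[ℝ] F) :
    IsConvexBody (L '' s) :=
  ⟨hs.1.linear_image L.toLinearMap, hs.2.1.image L.continuous, hs.2.2.image L⟩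

/-- Valuations as functions of sets; their values matter only on convex bodies. -/
def IsSetValuation (ψ : Set E → A) : Prop :=
  ∀ s t, IsConvexBody s → IsConvexBody t → Convex ℝ (s ∪ t) → ψ (s ∪ t) = ψ s + ψ t - ψ (s ∩ t)

open Classical in
/-- The extension by zero to all sets of a function on convex bodies. -/
noncomputable def setExtension (φ : ConvexBody E → A) (s : Set E) : A :=
  if h : IsConvexBody s then φ ⟨s, h.1, h.2.1, h.2.2⟩ else 0

theorem setExtension_coe (φ : ConvexBody E → A) (K : ConvexBody E) :
    setExtension φ (K : Set E) = φ K := by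
  rw [setExtension, dif_pos K.isConvexBody]
  rfl

/-- A segment is connected, so two closed sets that cover it and both meet it must meet on it. -/
theorem exists_mem_segment_inter {s t : Set E} (hs : IsConvexBody s) (ht : IsConvexBody t)
    (hst : Convex ℝ (s ∪ t)) {x y : E} (hx : x ∈ s) (hy : y ∈ t) :
    ∃ z ∈ segment ℝ x y, z ∈ s ∩ t :=
  isPreconnected_closed_iff.1 (convex_segment x y).isPreconnected s t hs.2.1.isClosed
    ht.2.1.isClosed (hst.segment_subset (Or.inl hx) (Or.inr hy))
    ⟨x, left_mem_segment ℝ x y, hx⟩ ⟨y, right_mem_segment ℝ x y, hy⟩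

theorem IsValuation.isSetValuation {φ : ConvexBody E → A} (hφ : IsValuation φ) :
    IsSetValuation (setExtension φ) := by
  intro s t hs ht hst
  have hU : IsConvexBody (s ∪ t) := ⟨hst, hs.2.1.union ht.2.1, hs.2.2.inl⟩
  obtain ⟨x, hx⟩ := hs.2.2
  obtain ⟨y, hy⟩ := ht.2.2
  obtain ⟨z, -, hzs, hzt⟩ := exists_mem_segment_inter hs ht hst hx hy
  have hI : IsConvexBody (s ∩ t) := hs.inter ht.1 ht.2.1.isClosed hzs hzt
  simp only [setExtension, dif_pos hs, dif_pos ht, dif_pos hU, dif_pos hI]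
  exact hφ _ _ _ _ rfl rfl

/-- Images under a non-injective `L` still commute with this intersection: if L x = L y, then L is
constant on the segment from x to y, which meets s ∩ t. -/
theorem IsSetValuation.image {ψ : Set F → A} (hψ : IsSetValuation ψ) (L : E →L[ℝ] F) :
    IsSetValuation fun s => ψ (L '' s) := by
  intro s t hs ht hst
  have hI : L '' (s ∩ t) = L '' s ∩ L '' t := by
    refine (Set.image_inter_subset _ _ _).antisymm ?_
    rintro _ ⟨⟨x, hx, rfl⟩, ⟨y, hy, hxy⟩⟩
    obtain ⟨z, hz, hzst⟩ := exists_mem_segment_inter hs ht hst hx hy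
    refine ⟨z, hzst, ?_⟩
    obtain ⟨a, b, -, -, hab, rfl⟩ := hz
    rw [map_add, map_smul, map_smul, hxy, ← add_smul, hab, one_smul]
  simp only [hI, Set.image_union]
  refine hψ _ _ (hs.image L) (ht.image L) ?_
  rw [← Set.image_union]
  exact hst.linear_image L.toLinearMap

/-- Cutting a convex body by a hyperplane that meets it. -/
theorem IsSetValuation.cut {ψ : Set E → A} (hψ : IsSetValuation ψ) {s : Set E}
    (hs : IsConvexBody s) (h : E →L[ℝ] ℝ) {a : E} (ha : a ∈ s) :
    ψ s = ψ (s ∩ {x | h a ≤ h x}) + ψ (s ∩ {x | h x ≤ h a}) - ψ (s ∩ {x | h x = h a}) := by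
  have h1 : IsConvexBody (s ∩ {x | h a ≤ h x}) :=
    hs.inter (convex_halfSpace_ge h.toLinearMap.isLinear _)
      (isClosed_le continuous_const h.continuous) ha (le_refl (h a))
  have h2 : IsConvexBody (s ∩ {x | h x ≤ h a}) :=
    hs.inter (convex_halfSpace_le h.toLinearMap.isLinear _)
      (isClosed_le h.continuous continuous_const) ha (le_refl (h a))
  have hU : (s ∩ {x | h a ≤ h x}) ∪ (s ∩ {x | h x ≤ h a}) = s := by
    rw [← Set.inter_union_distrib_left, Set.inter_eq_left]
    exact fun x _ => le_total (h a) (h x)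
  have hI : (s ∩ {x | h a ≤ h x}) ∩ (s ∩ {x | h x ≤ h a}) = s ∩ {x | h x = h a} := by
    ext x
    simp only [Set.mem_inter_iff, Set.mem_ofPred_eq]
    exact ⟨fun hx => ⟨hx.1.1, hx.2.2.antisymm hx.1.2⟩, fun hx => ⟨⟨hx.1, hx.2.ge⟩, hx.1, hx.2.le⟩⟩
  have := hψ _ _ h1 h2 (hU.symm ▸ hs.1)
  rwa [hU, hI] at this

/-- Inclusion-exclusion for the dissection of a convex body into the pieces on which one of the
linear forms `uᵢ`, `i ∈ W`, is minimal. -/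
theorem IsSetValuation.sum_minimal_pieces {ψ : Set E → A} (hψ : IsSetValuation ψ) {κ : Type*}
    [DecidableEq κ] (u : κ → E →L[ℝ] ℝ) {W : Finset κ} (hW : W.Nonempty) {Q : Set E}
    (hQ : IsConvexBody Q) {q : E} (hq : q ∈ Q) (hu : ∀ i ∈ W, ∀ j ∈ W, u i q = u j q) :
    ∑ S ∈ W.powerset, (-1 : ℤ) ^ S.card •
      ψ (Q ∩ {x | ∀ i ∈ S, ∀ j ∈ W, u i x ≤ u j x}) = 0 := by
  have hcl (S W : Finset κ) : IsClosed {x | ∀ i ∈ S, ∀ j ∈ W, u i x ≤ u j x} := by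
    simp only [Set.ofPred_forall]
    exact isClosed_biInter fun i _ => isClosed_biInter fun j _ =>
      isClosed_le (u i).continuous (u j).continuous
  have hcv (S W : Finset κ) : Convex ℝ {x | ∀ i ∈ S, ∀ j ∈ W, u i x ≤ u j x} := by
    intro x hx y hy a b ha hb _ i hi j hj
    have h1 := mul_le_mul_of_nonneg_left (hx i hi j hj) ha
    have h2 := mul_le_mul_of_nonneg_left (hy i hi j hj) hb
    simp only [map_add, map_smul, smul_eq_mul]
    linarith
  induction hW using Finset.Nonempty.cons_induction generalizing Q with
  | singleton k =>
    rw [← insert_empty_eq, Finset.sum_powerset_insert (Finset.notMem_empty k)]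
    simp
  | cons k W hk hW ih =>
    rw [Finset.cons_eq_insert] at hu ⊢
    have huW : ∀ i ∈ W, ∀ j ∈ W, u i q = u j q := fun i hi j hj =>
      hu i (Finset.mem_insert_of_mem hi) j (Finset.mem_insert_of_mem hj)
    set Q' : Set E := Q ∩ {x | ∀ i ∈ ({k} : Finset κ), ∀ j ∈ W, u i x ≤ u j x} with hQ'
    have hqQ' : q ∈ Q' := ⟨hq, fun i hi j hj => (hu i (by simp_all) j (by simp_all)).le⟩
    have hbQ' : IsConvexBody Q' := hQ.inter (hcv _ _) (hcl _ _) hq hqQ'.2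
    -- All uᵢ with i ∈ S agree on the S-piece, so for s ∈ S it can be cut by u k = u s. The two
    -- sides are the S-piece for `insert k W` and the S-piece of Q'; the section is the piece for
    -- `insert k S`. The common point q keeps every piece nonempty.
    have key : ∀ S ⊆ W, ψ (Q ∩ {x | ∀ i ∈ S, ∀ j ∈ insert k W, u i x ≤ u j x}) -
        ψ (Q ∩ {x | ∀ i ∈ insert k S, ∀ j ∈ insert k W, u i x ≤ u j x}) =
        ψ (Q ∩ {x | ∀ i ∈ S, ∀ j ∈ W, u i x ≤ u j x}) -
        ψ (Q' ∩ {x | ∀ i ∈ S, ∀ j ∈ W, u i x ≤ u j x}) := by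
      intro S hS
      rcases S.eq_empty_or_nonempty with rfl | ⟨s, hs⟩
      · simp [hQ']
      · have hqS : q ∈ {x | ∀ i ∈ S, ∀ j ∈ W, u i x ≤ u j x} := fun i hi j hj =>
          (huW i (hS hi) j hj).le
        have hcut := hψ.cut (hQ.inter (hcv S W) (hcl S W) hq hqS) (u k - u s) ⟨hq, hqS⟩
        have hz : (u k - u s) q = 0 := by
          simp [hu k (by simp) s (by simp [hS hs])]
        have e1 : Q ∩ {x | ∀ i ∈ S, ∀ j ∈ W, u i x ≤ u j x} ∩ {x | 0 ≤ (u k - u s) x} =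
            Q ∩ {x | ∀ i ∈ S, ∀ j ∈ insert k W, u i x ≤ u j x} := by
          ext x
          simp only [Set.mem_inter_iff, Set.mem_ofPred_eq, Finset.forall_mem_insert,
            sub_apply, sub_nonneg]
          constructor
          · rintro ⟨⟨hx, h⟩, h'⟩
            exact ⟨hx, fun i hi => ⟨(h i hi s (hS hs)).trans h', h i hi⟩⟩
          · rintro ⟨hx, h⟩
            exact ⟨⟨hx, fun i hi => (h i hi).2⟩, (h s hs).1⟩
        have e2 : Q ∩ {x | ∀ i ∈ S, ∀ j ∈ W, u i x ≤ u j x} ∩ {x | (u k - u s) x ≤ 0} =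
            Q' ∩ {x | ∀ i ∈ S, ∀ j ∈ W, u i x ≤ u j x} := by
          ext x
          simp only [hQ', Set.mem_inter_iff, Set.mem_ofPred_eq, Finset.mem_singleton, forall_eq,
            sub_apply, sub_nonpos]
          constructor
          · rintro ⟨⟨hx, h⟩, h'⟩
            exact ⟨⟨hx, fun j hj => h'.trans (h s hs j hj)⟩, h⟩
          · rintro ⟨⟨hx, h⟩, h'⟩
            exact ⟨⟨hx, h'⟩, h s (hS hs)⟩
        have e3 : Q ∩ {x | ∀ i ∈ S, ∀ j ∈ W, u i x ≤ u j x} ∩ {x | (u k - u s) x = 0} =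
            Q ∩ {x | ∀ i ∈ insert k S, ∀ j ∈ insert k W, u i x ≤ u j x} := by
          ext x
          simp only [Set.mem_inter_iff, Set.mem_ofPred_eq, Finset.forall_mem_insert,
            sub_apply, sub_eq_zero]
          constructor
          · rintro ⟨⟨hx, h⟩, h'⟩
            exact ⟨hx, ⟨le_rfl, fun j hj => h' ▸ h s hs j hj⟩,
              fun i hi => ⟨h' ▸ h i hi s (hS hs), h i hi⟩⟩
          · rintro ⟨hx, ⟨-, h⟩, h'⟩
            exact ⟨⟨hx, fun i hi => (h' i hi).2⟩, (h s (hS hs)).antisymm (h' s hs).1⟩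
        rw [hz, e1, e2, e3] at hcut
        rw [hcut]
        abel
    have hsum := congrArg₂ (· - ·) (ih hQ hq huW) (ih hbQ' hqQ' huW)
    simp only [← Finset.sum_sub_distrib, sub_zero, ← smul_sub] at hsum
    rw [Finset.sum_powerset_insert hk, ← Finset.sum_add_distrib, ← hsum]
    refine Finset.sum_congr rfl fun S hS => ?_
    have hS' := Finset.mem_powerset.1 hS
    rw [← key S hS', Finset.card_insert_of_notMem fun h => hk (hS' h), pow_succ, mul_neg_one,
      neg_smul, smul_sub, sub_eq_add_neg]

end SetValuations

/-! ### Alternating sums of half-space cuts of simplices. -/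

section Simplices

variable {ι : Type*} {A : Type*} [AddCommGroup A] (ψ : Set (ι → ℝ) → A) (a : ι → ℝ)

/-- The alternating sum of the values of `ψ` on the parts of a set cut out by the half-spaces
`aᵢ ≤ tᵢ`, for sets of indices `i` from a list. -/
def alternatingCut : List ι → Set (ι → ℝ) → A
  | [], s => ψ s
  | i :: l, s => alternatingCut l s - alternatingCut l (s ∩ {t | a i ≤ t i})

variable [Fintype ι] {ψ a}

theorem isConvexBody_inter_ge {s : Set (ι → ℝ)} (hs : IsConvexBody s) (ha : a ∈ s) (i : ι) :
    IsConvexBody (s ∩ {t | a i ≤ t i}) :=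
  hs.inter (convex_halfSpace_ge (LinearMap.proj (R := ℝ) (φ := fun _ : ι => ℝ) i).isLinear _)
    (isClosed_le continuous_const (continuous_apply i)) ha (le_refl (a i))

theorem isConvexBody_inter_le {s : Set (ι → ℝ)} (hs : IsConvexBody s) (ha : a ∈ s) (i : ι) :
    IsConvexBody (s ∩ {t | t i ≤ a i}) :=
  hs.inter (convex_halfSpace_le (LinearMap.proj (R := ℝ) (φ := fun _ : ι => ℝ) i).isLinear _)
    (isClosed_le (continuous_apply i) continuous_const) ha (le_refl (a i))

theorem isConvexBody_inter_eq {s : Set (ι → ℝ)} (hs : IsConvexBody s) (ha : a ∈ s) (i : ι) :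
    IsConvexBody (s ∩ {t | t i = a i}) :=
  hs.inter (convex_hyperplane (LinearMap.proj (R := ℝ) (φ := fun _ : ι => ℝ) i).isLinear _)
    (isClosed_eq (continuous_apply i) continuous_const) ha rfl

theorem alternatingCut_cut (hψ : IsSetValuation ψ) (l : List ι) {s : Set (ι → ℝ)}
    (hs : IsConvexBody s) (ha : a ∈ s) (j : ι) :
    alternatingCut ψ a l s - alternatingCut ψ a l (s ∩ {t | a j ≤ t j}) =
      alternatingCut ψ a l (s ∩ {t | t j ≤ a j}) - alternatingCut ψ a l (s ∩ {t | t j = a j}) := by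
  induction l generalizing s with
  | nil =>
    have := hψ.cut hs (ContinuousLinearMap.proj (R := ℝ) (φ := fun _ : ι => ℝ) j) ha
    simp only [ContinuousLinearMap.proj_apply] at this
    simp only [alternatingCut]
    rw [this]
    abel
  | cons i l ih =>
    have h1 := ih hs ha
    have h2 := ih (isConvexBody_inter_ge hs ha i) ⟨ha, le_refl (a i)⟩
    simp only [alternatingCut, Set.inter_right_comm s _ {t | a i ≤ t i}]
    rw [sub_sub_sub_comm, h1, h2, sub_sub_sub_comm]

/-- By `alternatingCut_cut`, each subtracted half-space can be traded for the opposite one and its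
boundary, so the alternating sum sees only the region tᵢ ≤ aᵢ. -/
theorem alternatingCut_congr (hψ : IsSetValuation ψ) (l : List ι) {s s' : Set (ι → ℝ)}
    (hs : IsConvexBody s) (ha : a ∈ s) (hs' : IsConvexBody s') (ha' : a ∈ s')
    (h : ∀ t, (∀ i ∈ l, t i ≤ a i) → (t ∈ s ↔ t ∈ s')) :
    alternatingCut ψ a l s = alternatingCut ψ a l s' := by
  induction l generalizing s s' with
  | nil =>
    obtain rfl : s = s' := Set.ext fun t => h t (by simp)
    rfl
  | cons i l ih =>
    simp only [alternatingCut]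
    rw [alternatingCut_cut hψ l hs ha, alternatingCut_cut hψ l hs' ha']
    congr 1
    · refine ih (isConvexBody_inter_le hs ha i) ⟨ha, le_refl (a i)⟩
        (isConvexBody_inter_le hs' ha' i) ⟨ha', le_refl (a i)⟩ fun t ht => and_congr_left fun hti => h t ?_
      simpa using ⟨hti, ht⟩
    · refine ih (isConvexBody_inter_eq hs ha i) ⟨ha, rfl⟩ (isConvexBody_inter_eq hs' ha' i)
        ⟨ha', rfl⟩ fun t ht => and_congr_left fun hti => h t ?_
      simpa using ⟨hti.le, ht⟩

/-- The simplex of points `t ≥ w` whose coordinates have sum `y + ∑ w`. -/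
def cornerSimplex (w : ι → ℝ) (y : ℝ) : Set (ι → ℝ) :=
  {t | (∀ i, w i ≤ t i) ∧ ∑ i, t i = y + ∑ i, w i}

/-- Cutting by tᵢ ≥ aᵢ moves the i-th coordinate of the corner from 0 to aᵢ and reduces the size by
aᵢ. As ψ depends on the size alone, each cut becomes a difference in the size. -/
theorem alternatingCut_cornerSimplex [DecidableEq ι]
    (hψ : ∀ w (y : ℝ≥0), ψ (cornerSimplex w y) = ψ (cornerSimplex 0 y)) (a : ι → ℝ≥0) (l : List ι)
    (hl : l.Nodup) (w : ι → ℝ) (hw : ∀ i ∈ l, w i = 0) (x : ℝ≥0) :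
    alternatingCut ψ (fun i => a i) l (cornerSimplex w (x + (l.map a).sum : ℝ≥0)) =
      iterDiff (l.map a) (fun y : ℝ≥0 => ψ (cornerSimplex 0 y)) x := by
  induction l generalizing w x with
  | nil => simp [alternatingCut, hψ w]
  | cons i l ih =>
    rw [List.nodup_cons] at hl
    have hw' : ∀ j ∈ l, w j = 0 := fun j hj => hw j (List.mem_cons_of_mem _ hj)
    have hi : w i = 0 := hw i List.mem_cons_self
    have hcut : cornerSimplex w (x + ((i :: l).map a).sum : ℝ≥0) ∩ {t | (a i : ℝ) ≤ t i} =
        cornerSimplex (Function.update w i (a i)) (x + (l.map a).sum : ℝ≥0) := by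
      have hsum : ∑ j, Function.update w i (a i : ℝ) j = a i + ∑ j, w j := by
        have hupd (j : ι) : Function.update w i (a i : ℝ) j =
            (Pi.single i (a i : ℝ) : ι → ℝ) j + w j := by
          rcases eq_or_ne j i with rfl | hj
          · simp [hi]
          · simp [hj]
        simp [hupd, Finset.sum_add_distrib]
      ext t
      simp only [cornerSimplex, Set.mem_inter_iff, Set.mem_ofPred_eq, hsum, List.map_cons,
        List.sum_cons, NNReal.coe_add]
      constructor
      · rintro ⟨⟨h1, h2⟩, h3⟩
        refine ⟨fun j => ?_, by linarith⟩
        rcases eq_or_ne j i with rfl | hj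
        · simpa using h3
        · simpa [hj] using h1 j
      · rintro ⟨h1, h2⟩
        have h3 := h1 i
        rw [Function.update_self] at h3
        refine ⟨⟨fun j => ?_, by linarith⟩, h3⟩
        rcases eq_or_ne j i with rfl | hj
        · rw [hi]
          exact (a j).2.trans h3
        · simpa [hj] using h1 j
    rw [alternatingCut, hcut, ih hl.2 _ (fun j hj => ?_), List.map_cons, iterDiff_cons,
      ← ih hl.2 w hw' (x + a i), List.sum_cons, add_assoc]
    rw [Function.update_of_ne (by rintro rfl; exact hl.1 hj), hw' j hj]

end Simplices

/-! ### Polynomiality of translation-invariant continuous valuations -/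

section Simplices

variable {ι : Type*} [Fintype ι] [Nonempty ι]

theorem cornerSimplex_eq_image (w : ι → ℝ) (y : ℝ≥0) :
    cornerSimplex w y = (fun t => w + (y : ℝ) • t) '' stdSimplex ℝ ι := by
  classical
  ext t
  constructor
  · rintro ⟨h1, h2⟩
    have hsum : ∑ i, (t i - w i) = y := by
      rw [Finset.sum_sub_distrib, h2]
      ring
    rcases eq_or_ne y 0 with rfl | hy
    · obtain ⟨i₀⟩ := ‹Nonempty ι›
      refine ⟨Pi.single i₀ 1, single_mem_stdSimplex ℝ i₀, ?_⟩
      have := (Finset.sum_eq_zero_iff_of_nonneg fun i _ => sub_nonneg.2 (h1 i)).1 hsum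
      funext i
      have := this i (Finset.mem_univ i)
      simp only [NNReal.coe_zero, zero_smul, add_zero]
      linarith
    · have hy' : (0 : ℝ) < y := NNReal.coe_pos.2 (pos_iff_ne_zero.2 hy)
      refine ⟨(y : ℝ)⁻¹ • (t - w), ⟨fun i => ?_, ?_⟩, ?_⟩
      · simp only [Pi.smul_apply, Pi.sub_apply, smul_eq_mul]
        exact mul_nonneg (inv_nonneg.2 hy'.le) (sub_nonneg.2 (h1 i))
      · simp only [Pi.smul_apply, Pi.sub_apply, smul_eq_mul]
        rw [← Finset.mul_sum, hsum, inv_mul_cancel₀ hy'.ne']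
      · simp only [smul_inv_smul₀ hy'.ne']
        abel
  · rintro ⟨s, hs, rfl⟩
    refine ⟨fun i => ?_, ?_⟩
    · simpa using mul_nonneg y.2 (hs.1 i)
    · simp only [Pi.add_apply, Pi.smul_apply, smul_eq_mul, Finset.sum_add_distrib,
        ← Finset.mul_sum, hs.2]
      ring

theorem isConvexBody_stdSimplex : IsConvexBody (stdSimplex ℝ ι) := by
  classical
  exact ⟨convex_stdSimplex ℝ ι, isCompact_stdSimplex ℝ ι, _,
    single_mem_stdSimplex ℝ (Classical.arbitrary ι)⟩

theorem isConvexBody_cornerSimplex_zero (y : ℝ≥0) : IsConvexBody (cornerSimplex (0 : ι → ℝ) y) := by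
  rw [cornerSimplex_eq_image]
  simp only [zero_add]
  exact isConvexBody_stdSimplex.image ((y : ℝ) • ContinuousLinearMap.id ℝ (ι → ℝ))

end Simplices

section Polynomiality

variable {V : Type*} [NormedAddCommGroup V] [NormedSpace ℝ V] {A : Type*} [AddCommGroup A]

theorem IsValuation.sub {φ φ' : ConvexBody V → A} (h : IsValuation φ) (h' : IsValuation φ') :
    IsValuation fun X => φ X - φ' X := by
  intro B C U I hU hI
  simp only [h B C U I hU hI, h' B C U I hU hI]
  abel

theorem IsValuation.smul {φ : ConvexBody V → A} (h : IsValuation φ) (r : ℝ≥0) :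
    IsValuation fun X => φ (r • X) := by
  intro B C U I hU hI
  -- Scaling by 0 need not commute with intersections of sets, but here all four terms equal φ 0.
  rcases eq_or_ne r 0 with rfl | hr
  · simp
  · refine h _ _ _ _ ?_ ?_
    · simp only [ConvexBody.coe_smul', hU, Set.smul_set_union]
    · simp only [ConvexBody.coe_smul', hI, Set.smul_set_inter₀ hr]

theorem IsValuation.iterDiff_smul {φ : ConvexBody V → A} (h : IsValuation φ) (l : List ℝ≥0)
    (x : ℝ≥0) : IsValuation fun X => iterDiff l (fun r => φ (r • X)) x := by
  induction l generalizing x with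
  | nil => exact h.smul x
  | cons a l ih => exact (ih (x + a)).sub (ih x)

/-- A convex body with at most `n` vertices satisfies the difference equation of order `n`. -/
theorem iterDiff_smul_convexHull_range {φ : ConvexBody V → A} (hφ : IsValuation φ)
    (hT : ∀ (v : V) (K K' : ConvexBody V), (K' : Set V) = (v + ·) '' (K : Set V) → φ K' = φ K)
    {n : ℕ} (v : Fin n → V) (P : ConvexBody V) (hP : (P : Set V) = convexHull ℝ (Set.range v))
    (l : List ℝ≥0) (hl : l.length = n) : iterDiff l (fun r => φ (r • P)) 0 = 0 := by
  subst hl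
  have hne : Nonempty (Fin l.length) := by
    have := P.nonempty
    rw [hP, convexHull_nonempty_iff, Set.range_nonempty_iff_nonempty] at this
    exact this
  let L : (Fin l.length → ℝ) →L[ℝ] V :=
    ∑ i, (ContinuousLinearMap.proj (R := ℝ) (φ := fun _ : Fin l.length => ℝ) i).smulRight (v i)
  have hL (t : Fin l.length → ℝ) : L t = ∑ i, t i • v i := by simp [L]
  have hLP : L '' stdSimplex ℝ (Fin l.length) = P := by
    rw [hP, ← convexHull_rangle_single_eq_stdSimplex, ← L.coe_coe, LinearMap.image_convexHull,
      ← Set.range_comp]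
    congr 2
    funext i
    simp [hL, Pi.single_apply]
  have hcorner (w : Fin l.length → ℝ) (y : ℝ≥0) :
      L '' cornerSimplex w y = (L w + ·) '' ((y • P : ConvexBody V) : Set V) := by
    rw [cornerSimplex_eq_image, ConvexBody.coe_smul', ← hLP, ← Set.image_smul, Set.image_image,
      Set.image_image, Set.image_image]
    simp [NNReal.smul_def]
  let ψ (s : Set (Fin l.length → ℝ)) : A := setExtension φ (L '' s)
  have hψ : IsSetValuation ψ := hφ.isSetValuation.image L
  have hψc (w : Fin l.length → ℝ) (y : ℝ≥0) : ψ (cornerSimplex w y) = φ (y • P) := by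
    let K : ConvexBody V := ⟨(L w + ·) '' ((y • P : ConvexBody V) : Set V),
      (y • P).convex.translate _, (y • P).isCompact.image (continuous_const_add _),
      (y • P).nonempty.image _⟩
    rw [← hT (L w) (y • P) K rfl, ← setExtension_coe φ K]
    exact congrArg (setExtension φ) (hcorner w y)
  let idx := List.finRange l.length
  have hmap : idx.map l.get = l := by simp [idx]
  have h1 := alternatingCut_cornerSimplex (ψ := ψ) (fun w y => by rw [hψc, hψc]) l.get idx
    (List.nodup_finRange _) 0 (fun _ _ => rfl) 0
  simp only [hψc, hmap, zero_add] at h1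
  rw [← h1]
  let a : Fin l.length → ℝ := fun i => l.get i
  have hsum : ((l.sum : ℝ≥0) : ℝ) = ∑ i, a i := by
    conv_lhs => rw [← hmap]
    rw [← Fin.sum_univ_def, NNReal.coe_sum]
  have hmem : a ∈ cornerSimplex 0 (l.sum : ℝ) := ⟨fun i => (l.get i).2, by simp [hsum]⟩
  -- In the simplex of size ∑ aᵢ, a point with all tᵢ ≤ aᵢ has the same coordinate sum as `a`, hence
  -- equals `a`.
  have h2 : alternatingCut ψ a idx (cornerSimplex 0 (l.sum : ℝ)) = alternatingCut ψ a idx {a} := by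
    refine alternatingCut_congr hψ idx (isConvexBody_cornerSimplex_zero _) hmem
      ⟨convex_singleton a, isCompact_singleton, Set.singleton_nonempty a⟩ rfl fun t ht => ?_
    refine ⟨fun h => ?_, fun h => (Set.mem_singleton_iff.1 h).symm ▸ hmem⟩
    have ht' : ∀ i, 0 ≤ a i - t i := fun i => sub_nonneg.2 (ht i (List.mem_finRange i))
    have h0 : ∑ i, (a i - t i) = 0 := by
      rw [Finset.sum_sub_distrib, h.2, hsum]
      simp
    have := (Finset.sum_eq_zero_iff_of_nonneg fun i _ => ht' i).1 h0
    exact funext fun i => (sub_eq_zero.1 (this i (Finset.mem_univ i))).symm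
  refine h2.trans ?_
  -- Cutting {a} leaves it unchanged, so a single index is enough to make the alternating sum
  -- cancel; one exists because P is nonempty.
  obtain ⟨i, l', hl'⟩ := List.exists_cons_of_ne_nil
    (List.ne_nil_of_mem (List.mem_finRange (Classical.arbitrary (Fin l.length))))
  have h3 : ({a} : Set (Fin l.length → ℝ)) ∩ {t | a i ≤ t i} = {a} :=
    Set.inter_eq_left.2 (Set.singleton_subset_iff.2 (le_refl (a i)))
  change alternatingCut ψ a (List.finRange l.length) {a} = 0
  rw [hl', alternatingCut, h3, sub_self]

/-- The relation between a polytope with affinely dependent vertices and polytopes with fewer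
vertices given by the minimal pieces of an affine dependence. -/
theorem setExtension_convexHull_eq_zero {φ : ConvexBody V → A} (hφ : IsValuation φ)
    (t : Finset V) (f : V → ℝ) (hf₁ : ∑ v ∈ t, f v • v = 0) (hf₀ : ∑ v ∈ t, f v = 0)
    (hf : ∃ v ∈ t, f v ≠ 0)
    (ih : ∀ t' ⊂ t, t'.Nonempty → setExtension φ (convexHull ℝ (t' : Set V)) = 0) :
    setExtension φ (convexHull ℝ (t : Set V)) = 0 := by
  classical
  obtain ⟨p, hp, hfp⟩ := Finset.exists_pos_of_sum_zero_of_exists_nonzero f hf₀ hf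
  obtain ⟨m, hm, hfm⟩ := Finset.exists_pos_of_sum_zero_of_exists_nonzero (s := t) (fun v => -f v)
    (by simp [hf₀]) (by simpa using hf)
  have hfm : f m < 0 := by simpa using hfm
  let α (i : t) : ℝ := f i
  have hα₁ : ∑ i : t, α i • (i : V) = 0 := by
    rw [← hf₁, ← Finset.sum_coe_sort t]
  have hα₀ : ∑ i : t, α i = 0 := by
    rw [← hf₀, ← Finset.sum_coe_sort t]
  have : Nonempty t := ⟨⟨p, hp⟩⟩
  let L : (t → ℝ) →L[ℝ] V :=
    ∑ i, (ContinuousLinearMap.proj (R := ℝ) (φ := fun _ : t => ℝ) i).smulRight (i : V)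
  have hL (w : t → ℝ) : L w = ∑ i : t, w i • (i : V) := by simp [L]
  have hLs (i : t) : L (Pi.single i 1) = i := by simp [hL, Pi.single_apply]
  let W : Finset t := Finset.univ.filter fun i => 0 < α i
  let u (i : t) : (t → ℝ) →L[ℝ] ℝ :=
    (α i)⁻¹ • ContinuousLinearMap.proj (R := ℝ) (φ := fun _ : t => ℝ) i
  have hu (i : t) (w : t → ℝ) : u i w = (α i)⁻¹ * w i := rfl
  have hW {i : t} : i ∈ W ↔ 0 < α i := by simp [W]
  have hmW : (⟨m, hm⟩ : t) ∉ W := fun h => (hW.1 h).not_gt hfm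
  -- The vertex of an index m with negative coefficient lies outside W, so every uᵢ with i ∈ W
  -- vanishes there; it serves as the common point.
  have hfan := (hφ.isSetValuation.image L).sum_minimal_pieces u (W := W) ⟨⟨p, hp⟩, hW.2 hfp⟩
    isConvexBody_stdSimplex (single_mem_stdSimplex ℝ ⟨m, hm⟩) fun i hi j hj => by
      have h (k : t) (hk : k ∈ W) : k ≠ ⟨m, hm⟩ := fun h => hmW (h ▸ hk)
      simp [hu, h i hi, h j hj]
  have hpiece : ∀ S ⊆ W, L '' (stdSimplex ℝ t ∩ {x | ∀ i ∈ S, ∀ j ∈ W, u i x ≤ u j x}) =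
      convexHull ℝ (((Finset.univ \ S).image ((↑) : t → V) : Finset V) : Set V) := by
    intro S hS
    refine Set.Subset.antisymm ?_ (convexHull_min ?_ ?_)
    · rintro _ ⟨w, ⟨hw, hwS⟩, rfl⟩
      -- Move from w along -α, which L kills, by the minimal ratio wᵢ/αᵢ over W. Coordinates stay
      -- nonnegative, and those in S, where the minimum is attained, become 0.
      obtain ⟨w', hw', hL', hwS'⟩ : ∃ w' ∈ stdSimplex ℝ t, L w' = L w ∧ ∀ i ∈ S, w' i = 0 := by
        rcases S.eq_empty_or_nonempty with rfl | ⟨s, hs⟩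
        · exact ⟨w, hw, rfl, by simp⟩
        · have hsW := hS hs
          have hu0 : 0 ≤ u s w := mul_nonneg (inv_nonneg.2 (hW.1 hsW).le) (hw.1 s)
          have hui {i : t} (hi : i ∈ W) : u i w * α i = w i := by
            rw [hu, mul_comm, mul_inv_cancel_left₀ (hW.1 hi).ne']
          refine ⟨fun i => w i - u s w * α i, ⟨fun i => ?_, ?_⟩, ?_, fun i hi => ?_⟩
          · by_cases hi : i ∈ W
            · have := mul_le_mul_of_nonneg_right (hwS s hs i hi) (hW.1 hi).le
              rw [hui hi] at this
              exact sub_nonneg.2 this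
            · have h1 : α i ≤ 0 := not_lt.1 fun h => hi (hW.2 h)
              have h2 := mul_nonpos_of_nonneg_of_nonpos hu0 h1
              have h3 := hw.1 i
              exact sub_nonneg.2 (h2.trans h3)
          · rw [Finset.sum_sub_distrib, ← Finset.mul_sum, hα₀, hw.2]
            simp
          · simp only [hL, sub_smul, Finset.sum_sub_distrib, mul_smul, ← Finset.smul_sum, hα₁]
            simp
          · have : u s w = u i w := (hwS s hs i (hS hi)).antisymm (hwS i hi s hsW)
            exact sub_eq_zero.2 (by rw [this, hui (hS hi)])
      rw [← hL', hL, ← Finset.sum_subset (Finset.sdiff_subset (s := Finset.univ) (t := S))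
        fun i _ hi => by rw [hwS' i (by simpa using hi), zero_smul]]
      refine (convex_convexHull ℝ _).sum_mem (fun i _ => hw'.1 i) ?_ fun i hi =>
        subset_convexHull ℝ _ (Finset.mem_coe.2 (Finset.mem_image_of_mem _ hi))
      rw [← hw'.2]
      exact Finset.sum_subset Finset.sdiff_subset fun i _ hi => hwS' i (by simpa using hi)
    · intro v hv
      obtain ⟨i, hi, rfl⟩ := Finset.mem_image.1 (Finset.mem_coe.1 hv)
      refine ⟨Pi.single i 1, ⟨single_mem_stdSimplex ℝ i, fun j hj k hk => ?_⟩, hLs i⟩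
      have hji : j ≠ i := by
        rintro rfl
        exact (Finset.mem_sdiff.1 hi).2 hj
      rw [hu, Pi.single_eq_of_ne hji, mul_zero]
      exact mul_nonneg (inv_nonneg.2 (hW.1 hk).le) ((single_mem_stdSimplex ℝ i).1 k)
    · refine Convex.linear_image ?_ L.toLinearMap
      refine (convex_stdSimplex ℝ t).inter fun x hx y hy a b ha hb _ i hi j hj => ?_
      have h1 := mul_le_mul_of_nonneg_left (hx i hi j hj) ha
      have h2 := mul_le_mul_of_nonneg_left (hy i hi j hj) hb
      simp only [map_add, map_smul, smul_eq_mul]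
      linarith
  rw [Finset.sum_eq_single ∅] at hfan
  · rw [hpiece ∅ (Finset.empty_subset _)] at hfan
    have : (Finset.univ \ (∅ : Finset t)).image ((↑) : t → V) = t := by
      ext v
      simp
    simpa [this] using hfan
  -- A nonempty S removes at least one vertex, while m always survives, so the induction hypothesis
  -- applies.
  · intro S hS hSne
    have hSW := Finset.mem_powerset.1 hS
    rw [hpiece S hSW, ih _ ?_ ?_, smul_zero]
    · refine Finset.ssubset_iff_subset_ne.2 ⟨fun v hv => ?_, fun h => ?_⟩
      · obtain ⟨i, -, rfl⟩ := Finset.mem_image.1 hv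
        exact i.2
      · obtain ⟨s, hs⟩ := Finset.nonempty_iff_ne_empty.2 hSne
        obtain ⟨i, hi, his⟩ := Finset.mem_image.1 ((Finset.ext_iff.1 h s).2 s.2)
        obtain rfl := Subtype.ext his
        exact (Finset.mem_sdiff.1 hi).2 hs
    · exact ⟨m, Finset.mem_image.2 ⟨⟨m, hm⟩, Finset.mem_sdiff.2 ⟨Finset.mem_univ _,
        fun h => hmW (hSW h)⟩, rfl⟩⟩
  · simp

theorem ConvexBody.exists_convexHull_dist_le (X : ConvexBody V) {ε : ℝ} (hε : 0 < ε) :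
    ∃ (t : Finset V) (P : ConvexBody V), t.Nonempty ∧ (P : Set V) = convexHull ℝ (t : Set V) ∧
      dist P X ≤ ε := by
  obtain ⟨c, hcX, hc, hcov⟩ := X.isCompact.finite_cover_balls hε
  have hne : c.Nonempty := by
    obtain ⟨x, hx⟩ := X.nonempty
    obtain ⟨y, hy, -⟩ := Set.mem_iUnion₂.1 (hcov hx)
    exact ⟨y, hy⟩
  let P : ConvexBody V := ⟨convexHull ℝ c, convex_convexHull ℝ c, hc.isCompact_convexHull ℝ,
    hne.convexHull⟩
  refine ⟨hc.toFinset, P, by simpa using hne, by simp [P], ?_⟩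
  refine Metric.hausdorffDist_le_of_mem_dist hε.le (fun x hx => ⟨x, ?_, by simpa using hε.le⟩)
    fun x hx => ?_
  · exact convexHull_min hcX X.convex hx
  · obtain ⟨y, hy, hxy⟩ := Set.mem_iUnion₂.1 (hcov hx)
    exact ⟨y, subset_convexHull ℝ c hy, (Metric.mem_ball.1 hxy).le⟩

/-- The dilates `φ(rX)` under a continuous translation-invariant valuation are a polynomial
function of `r` of degree at most the dimension. -/
theorem IsValuation.iterDiff_smul_eq_zero [FiniteDimensional ℝ V] [TopologicalSpace A]
    [IsTopologicalAddGroup A] [T2Space A] {φ : ConvexBody V → A} (hφ : IsValuation φ)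
    (hc : Continuous φ)
    (hT : ∀ (v : V) (K K' : ConvexBody V), (K' : Set V) = (v + ·) '' (K : Set V) → φ K' = φ K)
    (l : List ℝ≥0) (hl : l.length = Module.finrank ℝ V + 1) (X : ConvexBody V) :
    iterDiff l (fun r => φ (r • X)) 0 = 0 := by
  let θ (X : ConvexBody V) : A := iterDiff l (fun r => φ (r • X)) 0
  have hθ : IsValuation θ := hφ.iterDiff_smul l 0
  have hθc : Continuous θ :=
    (continuous_iterDiff (F := fun r X => φ (r • X)) (hc.comp ConvexBody.continuous_smul) l).comp
      (continuous_const.prodMk continuous_id)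
  have hpoly (t : Finset V) (ht : t.Nonempty) :
      setExtension θ (convexHull ℝ (t : Set V)) = 0 := by
    induction t using Finset.strongInduction with
    | H t ih =>
      by_cases hcard : t.card ≤ l.length
      · let P : ConvexBody V := ⟨convexHull ℝ (t : Set V), convex_convexHull ℝ _,
          t.finite_toSet.isCompact_convexHull ℝ, ht.to_set.convexHull⟩
        have hne : Nonempty t := ht.to_subtype
        obtain ⟨g⟩ := Function.Embedding.nonempty_of_card_le
          (α := t) (β := Fin l.length) (by simpa using hcard)
        -- Fewer than d+1 vertices are listed with repetitions, so that there are exactly as many as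
        -- steps in `l`.
        have hs := Function.invFun_surjective g.injective
        have hP : (P : Set V) =
            convexHull ℝ (Set.range fun i => ((Function.invFun g i : t) : V)) := by
          change convexHull ℝ (t : Set V) = _
          congr 1
          rw [Set.range_comp' Subtype.val, hs.range_eq]
          simp
        exact (setExtension_coe θ P).trans (iterDiff_smul_convexHull_range hφ hT _ P hP l rfl)
      · obtain ⟨f, hf₁, hf₀, hf⟩ :=
          Module.exists_nontrivial_relation_sum_zero_of_finrank_succ_lt_card (R := ℝ) (t := t)
            (by omega)
        exact setExtension_convexHull_eq_zero hθ t f hf₁ hf₀ hf ih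
  have hclosed : IsClosed (θ ⁻¹' {0}) := isClosed_singleton.preimage hθc
  refine hclosed.closure_subset (Metric.mem_closure_iff.2 fun ε hε => ?_ : X ∈ closure (θ ⁻¹' {0}))
  obtain ⟨t, P, ht, hP, hd⟩ := X.exists_convexHull_dist_le (half_pos hε)
  refine ⟨P, ?_, by rw [dist_comm]; linarith⟩
  have := hpoly t ht
  rwa [← hP, setExtension_coe] at this

end Polynomiality

/-! ### Dilations of the group of convex bodies -/

section Dilations

variable {V : Type*} [NormedAddCommGroup V] [NormedSpace ℝ V] [FiniteDimensional ℝ V]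
  {G : Subgroup (V ≃ᵃ[ℝ] V)}

theorem universalValuation_translate (hG : ∀ v : V, AffineEquiv.constVAdd ℝ V v ∈ G) (v : V)
    (K K' : ConvexBody V) (h : (K' : Set V) = (v + ·) '' (K : Set V)) :
    universalValuation G K' = universalValuation G K := by
  rw [← isAffineInvariant_universalValuation G _ (hG v) K]
  exact congrArg _ (ConvexBody.ext h)

/-- The linear part of g commutes with scaling, so r(gK) is the translate of g(rK) by r g(0) - g(0).
-/
theorem universalValuation_smul_affineImage (hG : ∀ v : V, AffineEquiv.constVAdd ℝ V v ∈ G)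
    {g : V ≃ᵃ[ℝ] V} (hg : g ∈ G) (r : ℝ≥0) (K : ConvexBody V) :
    universalValuation G (r • affineImage g K) = universalValuation G (r • K) := by
  rw [← isAffineInvariant_universalValuation G g hg (r • K)]
  refine universalValuation_translate hG (r • g 0 - g 0) _ _ ?_
  have key (x : V) : (r • g 0 - g 0) + g (r • x) = r • g x := by
    have h (y : V) : g y = g.linear y + g 0 := by
      simpa using g.map_vadd 0 y
    rw [h (r • x), h x, NNReal.smul_def, NNReal.smul_def, NNReal.smul_def, map_smul, smul_add]
    abel
  change (r • ·) '' (g '' (K : Set V)) =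
    (fun y => (r • g 0 - g 0) + y) '' (g '' ((r • ·) '' (K : Set V)))
  rw [Set.image_image, Set.image_image, Set.image_image]
  simp only [key]

/-- Lifting each r separately would give continuity only in the second variable. Lifting once into
C([0,∞), CB) gives joint continuity, since evaluation is jointly continuous on the locally compact
space [0,∞). -/
theorem exists_isDilationMap (hG : ∀ v : V, AffineEquiv.constVAdd ℝ V v ∈ G) :
    ∃ D : ℝ≥0 → CB V G →+ CB V G, IsDilationMap G D := by
  let F : C(ConvexBody V × ℝ≥0, CB V G) :=
    ⟨fun p => universalValuation G (p.2 • p.1), (continuous_universalValuation G).comp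
      (ConvexBody.continuous_smul.comp continuous_swap)⟩
  obtain ⟨f, hf, hfX⟩ := CB.exists_lift (G := G) (φ := F.curry) (map_continuous _)
    (fun B C U I hU hI => by
      ext r
      exact (isValuation_universalValuation G).smul r B C U I hU hI)
    (fun g hg K => by
      ext r
      exact universalValuation_smul_affineImage hG hg r K)
  refine ⟨fun r => AddMonoidHom.mk' (fun x => f x r) fun x y => by simp, ?_, fun r X => ?_⟩
  · exact (hf.comp continuous_snd).eval continuous_fst
  · exact congrArg (fun h : C(ℝ≥0, CB V G) => h r) (hfX X)

variable {D : ℝ≥0 → CB V G →+ CB V G}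

theorem IsDilationMap.unique {D' : ℝ≥0 → CB V G →+ CB V G} (hD : IsDilationMap G D)
    (hD' : IsDilationMap G D') : D' = D :=
  funext fun r => CB.hom_ext fun X => by rw [hD.2, hD'.2]

theorem IsDilationMap.one_apply (hD : IsDilationMap G D) (x : CB V G) : D 1 x = x :=
  DFunLike.congr_fun (CB.hom_ext (f := D 1) (g := AddMonoidHom.id _) fun X => by simp [hD.2]) x

theorem IsDilationMap.apply_apply (hD : IsDilationMap G D) (r s : ℝ≥0) (x : CB V G) :
    D r (D s x) = D (r * s) x :=
  DFunLike.congr_fun (CB.hom_ext (f := (D r).comp (D s)) (g := D (r * s)) fun X => by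
    simp [hD.2, mul_smul]) x

theorem IsDilationMap.iterDiff_eq_zero (hG : ∀ v : V, AffineEquiv.constVAdd ℝ V v ∈ G)
    (hD : IsDilationMap G D) (x : CB V G) (l : List ℝ≥0)
    (hl : l.length = Module.finrank ℝ V + 1) : iterDiff l (fun r => D r x) 0 = 0 := by
  refine CB.induction (p := fun x => iterDiff l (fun r => D r x) 0 = 0) ?_ (fun X => ?_)
    (fun x hx => ?_) (fun x y hx hy => ?_) x
  · simp only [map_zero, iterDiff_zero]
  · simp only [hD.2]
    exact (isValuation_universalValuation G).iterDiff_smul_eq_zero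
      (continuous_universalValuation G) (universalValuation_translate hG) l hl X
  · have := iterDiff_map (-AddMonoidHom.id (CB V G)) l (fun r => D r x) 0
    simpa [hx] using this
  · simp only [map_add, iterDiff_add, hx, hy, add_zero]

variable {d : ℕ} {ρ : Fin (d + 1) → ℝ≥0 → CB V G → CB V G}

theorem dilationComponent_add
    (hρ : ∀ x, IsPolynomialExpansion (fun r => D r x) (fun i r => ρ i r x))
    (i : Fin (d + 1)) (b : ℝ≥0) (x y : CB V G) : ρ i b (x + y) = ρ i b x + ρ i b y := by
  refine congrFun (congrFun ((hρ (x + y)).unique (c' := fun i b => ρ i b x + ρ i b y)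
    ⟨fun a b => ?_, fun i hi a b => ?_, fun a => ?_⟩) i) b
  · exact congrArg₂ (· + ·) ((hρ x).1 a b) ((hρ y).1 a b)
  · exact (congrArg₂ (· + ·) ((hρ x).2.1 i hi a b) ((hρ y).2.1 i hi a b)).trans
      (add_add_add_comm _ _ _ _)
  · simp only [Finset.sum_add_distrib, map_add]
    exact congrArg₂ (· + ·) ((hρ x).2.2 a) ((hρ y).2.2 a)

theorem dilationComponent_dilation (hD : IsDilationMap G D)
    (hρ : ∀ x, IsPolynomialExpansion (fun r => D r x) (fun i r => ρ i r x))
    (i : Fin (d + 1)) (b s : ℝ≥0) (x : CB V G) :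
    ρ i b (D s x) = ρ i (b * s ^ (i : ℕ)) x := by
  refine congrFun (congrFun ((hρ (D s x)).unique (c' := fun i b => ρ i (b * s ^ (i : ℕ)) x)
    ⟨fun a b => (hρ x).1 _ _, fun i hi a b => ?_, fun a => ?_⟩) i) b
  · simp only [add_mul]
    exact (hρ x).2.1 i hi _ _
  · simp only [hD.apply_apply, ← mul_pow]
    exact (hρ x).2.2 (a * s)

/-- Applying ρ_i(b, -) to the expansion of D(s, x) in s must give the expansion of ρ_i(b s^i, x),
which has a single term; uniqueness compares coefficients. -/
theorem dilationComponent_dilationComponent (hD : IsDilationMap G D)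
    (hρ : ∀ x, IsPolynomialExpansion (fun r => D r x) (fun i r => ρ i r x))
    (i j : Fin (d + 1)) (b s : ℝ≥0) (x : CB V G) :
    ρ i b (ρ j s x) = if i = j then ρ i (b * s) x else 0 := by
  let R : CB V G →+ CB V G := AddMonoidHom.mk' (ρ i b) (dilationComponent_add hρ i b)
  have h₁ : IsPolynomialExpansion (fun s => R (D s x)) (fun j s => R (ρ j s x)) := by
    refine ⟨fun a b => congrArg R ((hρ x).1 a b), fun j hj a b => ?_, fun a => ?_⟩
    · exact (congrArg R ((hρ x).2.1 j hj a b)).trans (map_add R _ _)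
    · exact (congrArg R ((hρ x).2.2 a)).trans (map_sum R _ _)
  have h₂ : IsPolynomialExpansion (fun s => R (D s x))
      (fun j s => if i = j then ρ i (b * s) x else 0) := by
    refine ⟨fun s s' => ?_, fun j hj s s' => ?_, fun a => ?_⟩
    · beta_reduce
      split_ifs with h
      · subst h
        exact (hρ x).1 _ _
      · rfl
    · beta_reduce
      split_ifs with h
      · subst h
        rw [mul_add]
        exact (hρ x).2.1 i hj _ _
      · simp
    · rw [Finset.sum_ite_eq, if_pos (Finset.mem_univ i)]
      exact dilationComponent_dilation hD hρ i b a x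
  exact congrFun (congrFun (h₁.unique h₂) j) s

/-- At r = 0 the body shrinks to the origin and the additive terms vanish. -/
theorem dilationComponent_zero_universalValuation (hD : IsDilationMap G D)
    (hρ : ∀ x, IsPolynomialExpansion (fun r => D r x) (fun i r => ρ i r x)) (b : ℝ≥0)
    (X : ConvexBody V) : ρ 0 b (universalValuation G X) = universalValuation G 0 := by
  have h0 := (hρ (universalValuation G X)).2.2 0
  rw [Finset.sum_eq_single 0] at h0
  · beta_reduce at h0
    rw [hD.2, zero_smul] at h0
    exact ((hρ _).1 _ _).trans h0.symm
  · intro i _ hi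
    have := (hρ (universalValuation G X)).2.1 i hi 0 0
    rw [zero_pow (Fin.val_ne_zero_iff.2 hi)]
    simpa using this
  · simp

/-- Scalar multiplication by reals on the components of positive degree. -/
theorem exists_module_of_dilationComponent (hD : IsDilationMap G D)
    (hρ : ∀ x, IsPolynomialExpansion (fun r => D r x) (fun i r => ρ i r x))
    {i : Fin (d + 1)} (hi : i ≠ 0) (hc : Continuous fun p : ℝ≥0 × CB V G => ρ i p.1 p.2)
    (e : CB V G →+ CB V G) (he : ∀ x, e x = ρ i 1 x) :
    ∃ _ : Module ℝ e.range, ContinuousSMul ℝ e.range ∧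
      ∀ (r : ℝ≥0) (y : e.range), (((r : ℝ) • y : e.range) : CB V G) = ρ i r y := by
  have hρρ (b s : ℝ≥0) (x : CB V G) : ρ i b (ρ i s x) = ρ i (b * s) x := by
    simpa using dilationComponent_dilationComponent hD hρ i i b s x
  have hmem (b : ℝ≥0) (x : CB V G) : ρ i b x ∈ e.range := ⟨ρ i b x, by rw [he, hρρ, one_mul]⟩
  have hρ0 (x : CB V G) : ρ i 0 x = 0 := by simpa using (hρ x).2.1 i hi 0 0
  have hρadd := dilationComponent_add hρ i
  let R (b : ℝ≥0) : CB V G →+ CB V G := AddMonoidHom.mk' (ρ i b) (hρadd b)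
  have hR (b : ℝ≥0) (x : CB V G) : ρ i b x = R b x := rfl
  -- The formula of `exists_addMonoidHom_eq_toNNReal_sub`, visibly continuous in (r, x).
  let sm (r : ℝ) (x : CB V G) : CB V G := ρ i r.toNNReal x - ρ i (-r).toNNReal x
  have hsm (r : ℝ≥0) (x : CB V G) : sm r x = ρ i r x := by
    simp [sm, hρ0, Real.toNNReal_of_nonpos]
  have hneg (r : ℝ) (x : CB V G) : sm (-r) x = -sm r x := by simp [sm]
  have hnegx (r : ℝ) (x : CB V G) : sm r (-x) = -sm r x := by
    simp only [sm, hR, map_neg]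
    abel
  have hreal (r : ℝ) : ∃ s : ℝ≥0, r = s ∨ r = -s := by
    rcases le_total 0 r with h | h
    · exact ⟨⟨r, h⟩, Or.inl rfl⟩
    · exact ⟨⟨-r, neg_nonneg.2 h⟩, Or.inr (neg_neg r).symm⟩
  have hmul (r s : ℝ) (x : CB V G) : sm (r * s) x = sm r (sm s x) := by
    have hpos (r s : ℝ≥0) : sm (r * s) x = sm r (sm s x) := by
      rw [hsm s, hsm r, hρρ, ← hsm, NNReal.coe_mul]
    obtain ⟨r, rfl | rfl⟩ := hreal r <;> obtain ⟨s, rfl | rfl⟩ := hreal s <;>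
      simp only [neg_mul, mul_neg, hneg, hnegx, hpos, neg_neg]
  let smul : SMul ℝ e.range := ⟨fun r y => ⟨sm r y, sub_mem (hmem _ _) (hmem _ _)⟩⟩
  have hcoe (r : ℝ) (y : e.range) : ((r • y : e.range) : CB V G) = sm r y := rfl
  refine ⟨Module.ofMinimalAxioms (fun r x y => Subtype.ext ?_) (fun r s x => Subtype.ext ?_)
    (fun r s x => Subtype.ext ?_) (fun x => Subtype.ext ?_), ⟨?_⟩, fun r y => hsm r y⟩
  · simp only [hcoe, AddSubgroup.coe_add, sm, hρadd]
    abel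
  · obtain ⟨g, hg⟩ := exists_addMonoidHom_eq_toNNReal_sub (c := fun b => ρ i b x) ((hρ x).2.1 i hi)
    simp only [hcoe, AddSubgroup.coe_add]
    exact (hg (r + s)).symm.trans ((map_add g r s).trans (congrArg₂ _ (hg r) (hg s)))
  · exact hmul r s x
  · obtain ⟨z, hz⟩ := x.2
    rw [hcoe, ← hz, ← NNReal.coe_one, hsm, he, hρρ, one_mul]
  · refine Continuous.subtype_mk ?_ _
    have h2 : Continuous fun p : ℝ × e.range => (p.2 : CB V G) :=
      continuous_subtype_val.comp continuous_snd
    exact (hc.comp ((continuous_real_toNNReal.comp continuous_fst).prodMk h2)).sub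
      (hc.comp ((continuous_real_toNNReal.comp continuous_fst.neg).prodMk h2))

/-- An idempotent endomorphism that sends all classes of convex bodies to the class of a point
has image isomorphic to `ℤ`, by the Euler characteristic. -/
theorem exists_continuousAddEquiv_int_range (e : CB V G →+ CB V G) (hidem : ∀ x, e (e x) = e x)
    (he : ∀ X, e (universalValuation G X) = universalValuation G 0) :
    ∃ β : ℤ ≃ₜ+ e.range, ((β 1 : e.range) : CB V G) = universalValuation G 0 := by
  obtain ⟨χ, hχ, hχX⟩ := CB.exists_lift (G := G) (A := ℤ) (φ := fun _ => 1) continuous_const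
    (fun _ _ _ _ _ _ => rfl) (fun _ _ _ => rfl)
  have heχ (x : CB V G) : e x = χ x • universalValuation G 0 :=
    -- Both sides send the class of every body to the class of the origin, as χ is 1 on bodies.
    DFunLike.congr_fun (CB.hom_ext (f := e)
      (g := ((zmultiplesHom _ (universalValuation G 0)).comp χ)) fun X => by
        simp [he, hχX]) x
  have hχ0 : χ (universalValuation G 0) = 1 := hχX 0
  have hmem (n : ℤ) : n • universalValuation G 0 ∈ e.range :=
    ⟨n • universalValuation G 0, by rw [map_zsmul, he]⟩
  let β : ℤ ≃ₜ+ e.range :=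
    { toFun := fun n => ⟨n • universalValuation G 0, hmem n⟩
      invFun := fun y => χ y
      left_inv := fun n => by simp [hχ0]
      right_inv := fun y => by
        refine Subtype.ext ?_
        obtain ⟨z, hz⟩ := y.2
        change χ y • universalValuation G 0 = y
        rw [← heχ, ← hz, hidem]
      map_add' := fun m n => Subtype.ext (add_zsmul _ m n)
      continuous_toFun := continuous_of_discreteTopology
      continuous_invFun := hχ.comp continuous_subtype_val }
  exact ⟨β, one_zsmul _⟩

end Dilations

/-- A complete system of continuous orthogonal idempotents splits a topological abelian group. -/
theorem exists_continuousAddEquiv_pi_range {M ι : Type*} [AddCommGroup M] [TopologicalSpace M]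
    [IsTopologicalAddGroup M] [Fintype ι] (e : ι → M →+ M) (hc : ∀ i, Continuous (e i))
    (hsum : ∀ x, ∑ i, e i x = x) (hidem : ∀ i x, e i (e i x) = e i x)
    (horth : ∀ i j, i ≠ j → ∀ x, e i (e j x) = 0) :
    ∃ T : M ≃ₜ+ ((i : ι) → (e i).range), ∀ x i, ((T x i : (e i).range) : M) = e i x := by
  let T : M ≃ₜ+ ((i : ι) → (e i).range) :=
    { toFun := fun x i => ⟨e i x, x, rfl⟩
      invFun := fun y => ∑ i, (y i : M)
      left_inv := hsum
      right_inv := fun y => by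
        funext i
        refine Subtype.ext ?_
        change e i (∑ j, (y j : M)) = y i
        rw [map_sum, Finset.sum_eq_single i]
        · obtain ⟨z, hz⟩ := (y i).2
          rw [← hz, hidem]
        · intro j _ hj
          obtain ⟨z, hz⟩ := (y j).2
          rw [← hz, horth i j hj.symm]
        · simp
      map_add' := fun x y => by
        funext i
        exact Subtype.ext (map_add (e i) x y)
      continuous_toFun := continuous_pi fun i => (hc i).subtype_mk _
      continuous_invFun := continuous_finsetSum _ fun i _ =>
        continuous_subtype_val.comp (continuous_apply i) }
  exact ⟨T, fun x i => rfl⟩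

set_option maxHeartbeats 800000 in
theorem theoremB {V : Type*} [NormedAddCommGroup V] [NormedSpace ℝ V] [FiniteDimensional ℝ V]
    (d : ℕ) (hd : Module.finrank ℝ V = d)
    (G : Subgroup (V ≃ᵃ[ℝ] V)) (hG : ∀ v : V, AffineEquiv.constVAdd ℝ V v ∈ G) :
    -- the dilation map `D` exists and is unique
    ∃ D : ℝ≥0 → CB V G →+ CB V G,
      IsDilationMap G D ∧ (∀ D', IsDilationMap G D' → D' = D) ∧
    -- it has unique dilation components `ρ₀, …, ρ_d`, which are continuous
    ∃ ρ : Fin (d + 1) → ℝ≥0 → CB V G → CB V G,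
      (∀ x, IsPolynomialExpansion (fun r => D r x) (fun i r => ρ i r x)) ∧
      (∀ ρ' : Fin (d + 1) → ℝ≥0 → CB V G → CB V G,
        (∀ x, IsPolynomialExpansion (fun r => D r x) (fun i r => ρ' i r x)) → ρ' = ρ) ∧
      (∀ i, Continuous (fun p : ℝ≥0 × CB V G => ρ i p.1 p.2)) ∧
    -- the McMullen idempotents `e_i = ρ_i(1, -)`: continuous endomorphisms which form a
    -- complete set of orthogonal idempotents
    ∃ e : Fin (d + 1) → CB V G →+ CB V G,
      (∀ i x, e i x = ρ i 1 x) ∧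
      (∀ i, Continuous (e i)) ∧
      (∀ x, ∑ i, e i x = x) ∧
      (∀ i x, e i (e i x) = e i x) ∧
      (∀ i j, i ≠ j → ∀ x, e i (e j x) = 0) ∧
    -- the summands `CB_i = e_i(CB)` are closed and Hausdorff
      T2Space (CB V G) ∧
      (∀ i, IsClosed ((e i).range : Set (CB V G)) ∧ T2Space (e i).range) ∧
    -- the group of convex bodies is their direct sum as a topological group, via the projections
    -- `e_i`, and `Φ = Φ₀ ⊕ ⋯ ⊕ Φ_d` for continuous `G`-invariant valuations `Φ_i`
    ∃ T : CB V G ≃ₜ+ ((i : Fin (d + 1)) → (e i).range),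
      (∀ x i, ((T x i : (e i).range) : CB V G) = e i x) ∧
    ∃ Φ : (i : Fin (d + 1)) → ConvexBody V → (e i).range,
      (∀ X i, T (universalValuation G X) i = Φ i X) ∧
      (∀ i, Continuous (Φ i) ∧ IsAffineInvariant G (Φ i) ∧ IsValuation (Φ i)) ∧
    -- `CB₀` is a copy of `ℤ`, generated by `Φ₀(X)` for any `X`, and by the class of any
    -- one-point convex body
      (∃ β : ℤ ≃ₜ+ (e 0).range,
        (∀ X, β 1 = Φ 0 X) ∧
        (∀ (X : ConvexBody V) (v : V), (X : Set V) = {v} →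
          ((β 1 : (e 0).range) : CB V G) = universalValuation G X)) ∧
    -- for `i ≥ 1`, `CB_i` is a real topological vector space, extending its structure of
    -- topological abelian group, and `Φ_i` is homogeneous of degree `i`
      (∀ i : Fin (d + 1), i ≠ 0 →
        ∃ _ : Module ℝ (e i).range,
          ContinuousSMul ℝ (e i).range ∧
          ∀ (r : ℝ), 0 ≤ r → ∀ X : ConvexBody V, Φ i (r • X) = r ^ (i : ℕ) • Φ i X) := by
  subst hd
  obtain ⟨D, hD⟩ := exists_isDilationMap hG
  refine ⟨D, hD, fun D' hD' => hD.unique hD', ?_⟩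
  obtain ⟨ρ, hρc, hρ⟩ := exists_polynomialExpansion (Module.finrank ℝ V) (fun r x => D r x) hD.1
    (hD.iterDiff_eq_zero hG)
  refine ⟨ρ, hρ, fun ρ' hρ' => ?_, hρc, ?_⟩
  · funext i r x
    exact congrFun (congrFun ((hρ' x).unique (hρ x)) i) r
  have hρρ := dilationComponent_dilationComponent hD hρ
  let e (i : Fin (Module.finrank ℝ V + 1)) : CB V G →+ CB V G :=
    AddMonoidHom.mk' (ρ i 1) (dilationComponent_add hρ i 1)
  have he (i x) : e i x = ρ i 1 x := rfl
  have hec (i) : Continuous (e i) := (hρc i).comp (continuous_const.prodMk continuous_id)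
  have hsum (x : CB V G) : ∑ i, e i x = x := by
    have := (hρ x).2.2 1
    simp only [one_pow, hD.one_apply] at this
    exact this.symm
  have hidem (i x) : e i (e i x) = e i x := by simp [he, hρρ]
  have horth (i j) (hij : i ≠ j) (x) : e i (e j x) = 0 := by simp [he, hρρ, hij]
  -- The image of an idempotent is its fixed set, which is closed in a Hausdorff group.
  have hrange (i) : ((e i).range : Set (CB V G)) = {x | e i x = x} := by
    ext x
    exact ⟨fun ⟨y, hy⟩ => by rw [← hy]; exact hidem i y, fun h => ⟨x, h⟩⟩
  refine ⟨e, he, hec, hsum, hidem, horth, inferInstance, fun i => ⟨?_, inferInstance⟩, ?_⟩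
  · rw [hrange]
    exact isClosed_eq (hec i) continuous_id
  obtain ⟨T, hT⟩ := exists_continuousAddEquiv_pi_range e hec hsum hidem horth
  refine ⟨T, hT, fun i X => T (universalValuation G X) i, fun X i => rfl,
    fun i => ⟨?_, fun g hg K => ?_, fun B C U I hU hI => ?_⟩, ?_, fun i hi => ?_⟩
  · exact (continuous_apply i).comp (T.continuous_toFun.comp (continuous_universalValuation G))
  · simp only [isAffineInvariant_universalValuation G g hg K]
  · refine Subtype.ext ?_
    rw [AddSubgroup.coe_sub, AddSubgroup.coe_add, hT, hT, hT, hT,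
      isValuation_universalValuation G B C U I hU hI, map_sub, map_add]
  · have hpt (X : ConvexBody V) : e 0 (universalValuation G X) = universalValuation G 0 :=
      dilationComponent_zero_universalValuation hD hρ 1 X
    obtain ⟨β, hβ⟩ := exists_continuousAddEquiv_int_range (e 0) (hidem 0) hpt
    refine ⟨β, fun X => Subtype.ext (by rw [hβ, hT, hpt]), fun X v hX => hβ.trans ?_⟩
    refine (universalValuation_translate hG v 0 X ?_).symm
    rw [hX]
    simp [Set.singleton_zero.symm]
  · obtain ⟨inst, hcont, hsmul⟩ :=
      exists_module_of_dilationComponent hD hρ hi (hρc i) (e i) (he i)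
    refine ⟨inst, hcont, fun r hr X => Subtype.ext ?_⟩
    lift r to ℝ≥0 using hr
    -- Dilating by r multiplies the argument of ρ_i by r^i, and ρ_i(r^i, -) is the scalar action on
    -- the image of e_i.
    have h : e i (universalValuation G (r • X)) =
        ρ i (r ^ (i : ℕ)) (e i (universalValuation G X)) := by
      rw [← hD.2, he, he, dilationComponent_dilation hD hρ, hρρ, if_pos rfl, one_mul, mul_one]
    rw [← NNReal.coe_pow, hsmul, hT, hT]
    exact h
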